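/- An affine $\mathbb{Z}$-VASS is a tuple $\mathcal{V} = (d, Q, T)$ with $d \in \mathbb{N}$, $Q$ a finite set of control-states and $T \subseteq Q \times \mathbb{Z}^{d\times d} \times \mathbb{Z}^d \times Q$ a finite set of transitions. For $p,q\in Q$ and $\mathbf{u},\mathbf{v}\in\mathbb{Z}^d$ we write $p(\mathbf{u}) \to q(\mathbf{v})$ if there is $(p, \mathbf{A}, \mathbf{b}, q) \in T$ with $\mathbf{v} = \mathbf{A}\mathbf{u} + \mathbf{b}$, and $\to^*$ denotes the reflexive-transitive closure (the reachability relation). Let $\|\cdot\|$ be the largest absolute value of an entry (of a vector, of a matrix, of all matrices of a finite set, or of all matrices and vectors in $T$; it is $0$ if there are no entries), let $|\mathcal{V}| = d + |Q| + (d^2+d)\cdot|T|\cdot\max(1, \lceil \log_2(\|T\|+1)\rceil)$, and let $\mathcal{M}_{\mathcal{V}}$ be the monoid generated by the matrices occurring in $T$. $\mathcal{V}$ is an afmp-$\mathbb{Z}$-VASS if $\mathcal{M}_{\mathcal{V}}$ is finite. **Theorem.** (1) There are a polynomial $P$ and an algorithm (a partial recursive function) which, given any afmp-$\mathbb{Z}$-VASS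 $\mathcal{V} = (d, Q, T)$ and $p, q \in Q$, halts and outputs an existential formula $\varphi_{\mathcal{V},p,q}(\mathbf{u}, \mathbf{v})$ of Presburger arithmetic, i.e. of first-order logic over $\mathbb{Z}$ with $0$, $1$, addition and order, such that for all $\mathbf{u},\mathbf{v} \in \mathbb{Z}^d$ $$\varphi_{\mathcal{V},p,q}(\mathbf{u}, \mathbf{v}) \text{ holds} \iff p(\mathbf{u}) \to^* q(\mathbf{v}) \text{ in } \mathcal{V},$$ and the size of $\varphi_{\mathcal{V},p,q}$ (the number of bits needed to write it down) is at most $P(|\mathcal{V}|, |\mathcal{M}_{\mathcal{V}}|, \lfloor\log_2 \|\mathcal{M}_{\mathcal{V}}\|\rfloor)$, where $\log_2 0$ is read as $0$ (this concerns only $d = 0$). (2) Hence, for every afmp-$\mathbb{Z}$-VASS $\mathcal{V} = (d,Q,T)$ and all $p, q \in Q$, the set $\{(\mathbf{u},\mathbf{v}) \in \mathbb{Z}^d \times \mathbb{Z}^d : p(\mathbf{u}) \to^* q(\mathbf{v})\}$ is semilinear, i.e. a finite union of sets $\mathbf{b} + \mathbb{N}\mathbf{p}_1 + \cdots + \mathbb{N}\mathbf{p}_k$.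 -/

import Mathlib

open FirstOrder

universe u

/-! ### Affine integer vector addition systems with states -/

/-- A transition `(src, mat, vec, tgt)` in `Q × ℤ^{d × d} × ℤ^d × Q`. -/
structure AffTransition (d : ℕ) (Q : Type u) where
  src : Q
  mat : Matrix (Fin d) (Fin d) ℤ
  vec : Fin d → ℤ
  tgt : Q

/-- An affine `ℤ`-VASS `(d, Q, T)`: a finite set `T` of transitions of dimension `d` over `Q`. -/
structure AffineZVASS (d : ℕ) (Q : Type u) where
  T : Finset (AffTransition d Q)

/-- The max-norm of an integer vector. -/
def vecNorm {d : ℕ} (x : Fin d → ℤ) : ℕ := Finset.univ.sup fun i => (x i).natAbs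

/-- The max-norm of an integer matrix (largest absolute value of an entry). -/
def matNorm {d : ℕ} (A : Matrix (Fin d) (Fin d) ℤ) : ℕ :=
  Finset.univ.sup fun i => Finset.univ.sup fun j => (A i j).natAbs

/-- The max-norm of a finite set of matrices. -/
noncomputable def matSetNorm {d : ℕ} (S : Set (Matrix (Fin d) (Fin d) ℤ)) : ℕ :=
  sSup (matNorm '' S)

namespace AffineZVASS

variable {d : ℕ} {Q : Type u}

/-- One step `c → c'` between configurations `(p, u)`, i.e. `p(u)`. -/
def Step (V : AffineZVASS d Q) (c c' : Q × (Fin d → ℤ)) : Prop :=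
  ∃ t ∈ V.T, c.1 = t.src ∧ c'.1 = t.tgt ∧ c'.2 = t.mat.mulVec c.2 + t.vec

/-- The reachability relation `c →* c'`. -/
def Reach (V : AffineZVASS d Q) : Q × (Fin d → ℤ) → Q × (Fin d → ℤ) → Prop :=
  Relation.ReflTransGen V.Step

/-- The monoid generated by the matrices of the transitions. -/
def monoid (V : AffineZVASS d Q) : Submonoid (Matrix (Fin d) (Fin d) ℤ) :=
  Submonoid.closure {A | ∃ t ∈ V.T, t.mat = A}

/-- The finite-monoid property: `V` is an afmp-`ℤ`-VASS. -/
def FiniteMonoid (V : AffineZVASS d Q) : Prop :=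
  (V.monoid : Set (Matrix (Fin d) (Fin d) ℤ)).Finite

/-- The largest absolute value of a coefficient occurring in a transition. -/
def normT (V : AffineZVASS d Q) : ℕ := V.T.sup fun t => max (vecNorm t.vec) (matNorm t.mat)

/-- The size `d + |Q| + (d² + d) · |T| · max(1, ⌈log₂(‖T‖ + 1)⌉)`. -/
def size [Fintype Q] (V : AffineZVASS d Q) : ℕ :=
  d + Fintype.card Q + (d ^ 2 + d) * V.T.card * max 1 (Nat.clog 2 (V.normT + 1))

end AffineZVASS

/-! ### Inputs of algorithms: an affine `ℤ`-VASS with two states, written as finite data -/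

/-- A transition as finite data: source, list of rows of the matrix, vector, target. -/
abbrev TransitionCode : Type := ℕ × List (List ℤ) × List ℤ × ℕ

/-- `(d, |Q|, T, p, q)` as finite data. -/
abbrev VASSInput : Type := ℕ × ℕ × List TransitionCode × ℕ × ℕ

/-- The code of a transition when the states are numbered by `e`. -/
def AffTransition.code {d n : ℕ} {Q : Type u} (e : Q ≃ Fin n) (t : AffTransition d Q) :
    TransitionCode :=
  ((e t.src : ℕ), List.ofFn (fun i => List.ofFn fun j => t.mat i j), List.ofFn t.vec,
    (e t.tgt : ℕ))

/-- `x` presents `V` together with the states `p`, `q`: the states are numbered `0, …, |Q| - 1`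
in some way, and the transitions are listed without repetition in some order. -/
def AffineZVASS.IsInput {d : ℕ} {Q : Type u} [Fintype Q] (V : AffineZVASS d Q) (p q : Q)
    (x : VASSInput) : Prop :=
  ∃ (e : Q ≃ Fin (Fintype.card Q)) (l : List (AffTransition d Q)),
    l.Nodup ∧ (∀ t, t ∈ l ↔ t ∈ V.T) ∧
    x = (d, Fintype.card Q, l.map (AffTransition.code e), (e p : ℕ), (e q : ℕ))

/-! ### Presburger arithmetic over `ℤ` with order -/

/-- The language `0, 1, +, ≤` of Presburger arithmetic with order. -/
abbrev presburgerOrd : Language := Language.sum Language.presburger Language.order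

/-- The usual order on `ℤ`; with `0, 1, +` it makes `ℤ` a `presburgerOrd`-structure. -/
instance intOrderStructure : Language.order.Structure ℤ := Language.orderStructure ℤ

instance intOrderedStructure : presburgerOrd.OrderedStructure ℤ := ⟨fun _ => Iff.rfl⟩

namespace Presburger

/-- The token of a function symbol. -/
def funcToken : {k : ℕ} → presburgerOrd.Functions k → ℕ
  | _, Sum.inl presburgerFunc.zero => 5
  | _, Sum.inl presburgerFunc.one => 6
  | _, Sum.inl presburgerFunc.add => 7

/-- The tokens of a variable: free variables are `u_i` and `v_i`, bound variables are numbered. -/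
def varTokens {d n : ℕ} : (Fin d ⊕ Fin d) ⊕ Fin n → List ℕ
  | Sum.inl (Sum.inl i) => [8, i]
  | Sum.inl (Sum.inr i) => [9, i]
  | Sum.inr k => [10, k]

/-- A term written out in Polish notation. -/
def termTokens {d n : ℕ} : presburgerOrd.Term ((Fin d ⊕ Fin d) ⊕ Fin n) → List ℕ
  | .var x => varTokens x
  | .func f ts => funcToken f :: (List.ofFn fun i => termTokens (ts i)).flatten

/-- A formula written out in Polish notation, as a finite sequence of tokens. The only relation
symbol is `≤`. -/
def tokens {d : ℕ} : {n : ℕ} → presburgerOrd.BoundedFormula (Fin d ⊕ Fin d) n → List ℕ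
  | _, .falsum => [0]
  | _, .equal t₁ t₂ => 1 :: (termTokens t₁ ++ termTokens t₂)
  | _, .rel _ ts => 2 :: (List.ofFn fun i => termTokens (ts i)).flatten
  | _, .imp φ ψ => 3 :: (tokens φ ++ tokens ψ)
  | _, .all φ => 4 :: tokens φ

/-- The size of a formula: the number of bits needed to write out its tokens in binary, with one
separator per token. -/
def formulaSize {d n : ℕ} (φ : presburgerOrd.BoundedFormula (Fin d ⊕ Fin d) n) : ℕ :=
  ((tokens φ).map fun k => Nat.size k + 1).sum

end Presburger

/-!
A run `p(u) →* q(v)` along transitions with matrices `A₁, …, Aₖ` and vectors `b₁, …, bₖ` ends in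
`v = Aₖ ⋯ A₁ u + ∑ᵢ Aₖ ⋯ Aᵢ₊₁ bᵢ`. If every state is paired with the product of the matrices still
to be applied, then runs become walks from `(p, M)` to `(q, 1)` in a finite graph, whose edges are
the pairs of a transition and an element of the matrix monoid, and `v` is `M u` plus a sum of
vectors attached to the edges (`ProductEdges.reach_iff`). So only the numbers of times that a walk
uses each edge matter.

By `exists_walk_count_iff`, a function `f` on the edges counts the edges of a walk from `s` to `t`
if and only if it satisfies Kirchhoff's law for a unit flow from `s` to `t` and there is a rank `z`
of the vertices such that every vertex other than `t` with an outgoing edge in the support of `f`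
has one along which `z` decreases. Given such a rank, a walk is found greedily: the descending edge
at a vertex is used last. Conversely, a vertex is ranked by when the walk leaves it for the last
time.

For a fixed support, these conditions on `f` are linear equations, which gives semilinearity
(`isSemilinearSet_walk_counts`). They are also expressed by a short existential formula, whose bound
variables are the multiplicities, the ranks, and the doublings `2 ^ k x` of the quantities `x` that
are multiplied by coefficients, so that coefficients are written in binary (`WalkProblem.system`,
`WalkProblem.Valid.exists_sat_iff`, `WalkProblem.Valid.cost_system_le`). The formula and its tokens
are produced from lists by primitive recursive functions. The only unbounded search is for a `k`
such that the products of at most `k` matrices are all of the monoid; it succeeds because the monoid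
is finite (`AffineZVASS.Presents.exists_stable`, `AffineZVASS.Presents.approx_of_stable`).
-/

/-! ### Walks in a finite directed multigraph and their edge counts -/

section Walk

variable {ι : Type*} {σ : Type*}

/-- `IsWalk src tgt s l t`: the list `l` of edges is a walk from `s` to `t` in the directed
multigraph with edge set `ι`, in which the edge `e` leads from `src e` to `tgt e`. -/
def IsWalk (src tgt : ι → σ) : σ → List ι → σ → Prop
  | s, [], t => s = t
  | s, e :: l, t => src e = s ∧ IsWalk src tgt (tgt e) l t

/-- Walks are transported along a renaming of the vertices that is injective on the vertices that
matter. -/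
theorem IsWalk.map_iff {τ : Type*} {src tgt : ι → σ} {g : σ → τ} {A : Set σ} (hg : A.InjOn g)
    (hsrc : ∀ e, src e ∈ A) (htgt : ∀ e, tgt e ∈ A) {t : σ} (ht : t ∈ A) (l : List ι) :
    ∀ {s : σ}, s ∈ A →
      (IsWalk (fun e => g (src e)) (fun e => g (tgt e)) (g s) l (g t) ↔ IsWalk src tgt s l t) := by
  induction l with
  | nil => intro s hs; exact hg.eq_iff hs ht
  | cons e l ih => intro s hs; exact and_congr (hg.eq_iff (hsrc e) hs) (ih (htgt e))

variable [Fintype ι] [DecidableEq σ]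

/-- The total multiplicity of the edges attached to `v` by `end_`: the outflow of `f` at `v` if
`end_` is the source map, and the inflow if it is the target map. -/
def flowAt (end_ : ι → σ) (f : ι → ℕ) (v : σ) : ℕ := ∑ e, if end_ e = v then f e else 0

/-- Kirchhoff's law for a flow of value one from `s` to `t`. -/
def IsUnitFlow (src tgt : ι → σ) (f : ι → ℕ) (s t : σ) : Prop :=
  ∀ v, flowAt tgt f v + (if v = s then 1 else 0) = flowAt src f v + (if v = t then 1 else 0)

/-- `z` certifies that, along edges in the support of `f`, one can reach `t` from every vertex that
emits flow: such a vertex, if it is not `t`, has an edge in the support along which `z`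
decreases. -/
def Descends (src tgt : ι → σ) (f : ι → ℕ) (t : σ) (z : σ → ℤ) : Prop :=
  ∀ e, f e = 0 ∨ src e = t ∨ ∃ e', src e' = src e ∧ 0 < f e' ∧ z (tgt e') < z (src e)

theorem flowAt_pos_iff {end_ : ι → σ} {f : ι → ℕ} {v : σ} :
    0 < flowAt end_ f v ↔ ∃ e, end_ e = v ∧ 0 < f e := by
  rw [flowAt, Finset.sum_pos_iff]
  refine exists_congr fun e => ?_
  by_cases h : end_ e = v <;> simp [h]

theorem flowAt_add_single [DecidableEq ι] (end_ : ι → σ) (f : ι → ℕ) (e₀ : ι) (v : σ) :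
    flowAt end_ (f + Pi.single e₀ 1) v = flowAt end_ f v + if v = end_ e₀ then 1 else 0 := by
  have h : ∀ e, (if end_ e = v then (f + Pi.single e₀ 1 : ι → ℕ) e else 0) =
      (if end_ e = v then f e else 0) + if e = e₀ then (if v = end_ e₀ then 1 else 0) else 0 := by
    intro e
    by_cases he : e = e₀
    · subst he
      by_cases hv : end_ e = v
      · simp [hv]
      · simp [hv, Ne.symm hv]
    · simp [he]
  simp only [flowAt, h, Finset.sum_add_distrib, Finset.sum_ite_eq', Finset.mem_univ, if_true]

theorem isUnitFlow_add_single_iff [DecidableEq ι] {src tgt : ι → σ} {f : ι → ℕ} {e₀ : ι} {t : σ} :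
    IsUnitFlow src tgt (f + Pi.single e₀ 1) (src e₀) t ↔ IsUnitFlow src tgt f (tgt e₀) t := by
  refine forall_congr' fun v => ?_
  rw [flowAt_add_single, flowAt_add_single]
  omega

/-- A unit flow without outflow at its origin, whose support leads down to `t`, vanishes: an edge
of the support whose source is lowest would lead to a lower one. -/
theorem IsUnitFlow.eq_zero {src tgt : ι → σ} {f : ι → ℕ} {s t : σ} {z : σ → ℤ}
    (hf : IsUnitFlow src tgt f s t) (hz : Descends src tgt f t z) (hs : flowAt src f s = 0) :
    s = t ∧ f = 0 := by
  have h1 := hf s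
  have hst : s = t := by
    by_contra h
    simp [hs, h] at h1
  subst hst
  refine ⟨rfl, ?_⟩
  by_contra hne
  obtain ⟨e₁, he₁⟩ := Function.ne_iff.1 hne
  obtain ⟨e, he, hmin⟩ := Finset.exists_min_image (Finset.univ.filter fun e => 0 < f e)
    (fun e => z (src e)) ⟨e₁, by simpa [Nat.pos_iff_ne_zero] using he₁⟩
  simp only [Finset.mem_filter, Finset.mem_univ, true_and] at he hmin
  have hpos : ∀ e, 0 < f e → src e ≠ s := fun e he h =>
    (flowAt_pos_iff.2 ⟨e, h, he⟩).ne' hs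
  rcases hz e with h | h | ⟨e', h', hfe', hlt⟩
  · omega
  · exact hpos e he h
  · have hin : 0 < flowAt tgt f (tgt e') := flowAt_pos_iff.2 ⟨e', rfl, hfe'⟩
    have hbal := hf (tgt e')
    have hout : 0 < flowAt src f (tgt e') := by omega
    obtain ⟨e'', hsrc, hfe''⟩ := flowAt_pos_iff.1 hout
    have := hmin e'' hfe''
    rw [hsrc] at this
    omega

/-- The first edge of a walk realising a flow can be chosen so that the rest of the flow still
leads down to `t`: the descending edge at the origin is used up last. -/
theorem Descends.exists_first_edge [DecidableEq ι] {src tgt : ι → σ} {f : ι → ℕ} {s t : σ}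
    {z : σ → ℤ} (hz : Descends src tgt f t z) (hs : 0 < flowAt src f s) :
    ∃ (e₀ : ι) (f' : ι → ℕ), src e₀ = s ∧ f = f' + Pi.single e₀ 1 ∧ Descends src tgt f' t z := by
  have key : ∃ e₀, src e₀ = s ∧ 0 < f e₀ ∧ (s = t ∨ ∀ e, src e = s → e ≠ e₀ ∨ 1 < f e₀ → 0 < f e →
      ∃ e', src e' = s ∧ (e' ≠ e₀ ∨ 1 < f e₀) ∧ 0 < f e' ∧ z (tgt e') < z s) := by
    obtain ⟨e, hes, hfe⟩ := flowAt_pos_iff.1 hs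
    rcases hz e with h | h | ⟨e₁, h₁, hf₁, hz₁⟩
    · omega
    · exact ⟨e, hes, hfe, .inl (hes ▸ h)⟩
    · rw [hes] at h₁ hz₁
      by_cases h : ∃ e₂, e₂ ≠ e₁ ∧ src e₂ = s ∧ 0 < f e₂
      · obtain ⟨e₂, hne, h₂, hf₂⟩ := h
        exact ⟨e₂, h₂, hf₂, .inr fun _ _ _ _ => ⟨e₁, h₁, .inl hne.symm, hf₁, hz₁⟩⟩
      · refine ⟨e₁, h₁, hf₁, .inr fun e' hs' hor hf' => ?_⟩
        rcases hor with hne | hlt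
        · exact absurd ⟨e', hne, hs', hf'⟩ h
        · exact ⟨e₁, h₁, .inr hlt, hf₁, hz₁⟩
  obtain ⟨e₀, hs₀, hf₀, hor⟩ := key
  have hval : ∀ e, Function.update f e₀ (f e₀ - 1) e = if e = e₀ then f e₀ - 1 else f e :=
    fun e => Function.update_apply ..
  refine ⟨e₀, Function.update f e₀ (f e₀ - 1), hs₀, ?_, fun e => ?_⟩
  · funext e
    rw [Pi.add_apply, hval]
    by_cases h : e = e₀
    · subst h; simp; omega
    · simp [h]
  · have hpos : ∀ e', 0 < Function.update f e₀ (f e₀ - 1) e' ↔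
        (e' ≠ e₀ ∨ 1 < f e₀) ∧ 0 < f e' := by
      intro e'
      rw [hval]
      by_cases h : e' = e₀
      · subst h; simp; omega
      · simp [h]
    by_cases h0 : Function.update f e₀ (f e₀ - 1) e = 0
    · exact .inl h0
    refine .inr (or_iff_not_imp_left.2 fun hne => ?_)
    obtain ⟨hor', hfe⟩ := (hpos e).1 (Nat.pos_of_ne_zero h0)
    by_cases hse : src e = s
    · have hst : s ≠ t := hse ▸ hne
      obtain ⟨e', h1, h2, h3, h4⟩ := (hor.resolve_left hst) e hse hor' hfe
      exact ⟨e', h1.trans hse.symm, (hpos e').2 ⟨h2, h3⟩, by rw [hse]; exact h4⟩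
    · rcases hz e with h | h | ⟨e', h1, h2, h3⟩
      · omega
      · exact absurd h hne
      · exact ⟨e', h1, (hpos e').2 ⟨.inl fun h => hse (by rw [← h1, h, hs₀]), h2⟩, h3⟩

theorem exists_walk_of_isUnitFlow [DecidableEq ι] {src tgt : ι → σ} {t : σ} {z : σ → ℤ} :
    ∀ (n : ℕ) (f : ι → ℕ) (s : σ), ∑ e, f e = n → IsUnitFlow src tgt f s t →
      Descends src tgt f t z → ∃ l : List ι, IsWalk src tgt s l t ∧ ∀ e, l.count e = f e := by
  intro n
  induction n with
  | zero =>
    intro f s hn hf hz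
    have h0 : f = 0 := by
      funext e
      exact (Finset.sum_eq_zero_iff.1 hn) e (Finset.mem_univ e)
    subst h0
    exact ⟨[], (hf.eq_zero hz (by simp [flowAt])).1, by simp⟩
  | succ n ih =>
    intro f s hn hf hz
    rcases Nat.eq_zero_or_pos (flowAt src f s) with h | h
    · obtain ⟨hst, h0⟩ := hf.eq_zero hz h
      exact ⟨[], hst, by simp [h0]⟩
    · obtain ⟨e₀, f', rfl, rfl, hz'⟩ := hz.exists_first_edge h
      obtain ⟨l, hl, hcount⟩ := ih f' (tgt e₀) (by
        simp only [Pi.add_apply, Finset.sum_add_distrib, Finset.sum_pi_single', Finset.mem_univ,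
          if_true] at hn
        omega) (isUnitFlow_add_single_iff.1 hf) hz'
      refine ⟨e₀ :: l, ⟨rfl, hl⟩, fun e => ?_⟩
      by_cases h : e = e₀
      · subst h; simp [hcount]
      · simp [hcount, h, List.count_cons_of_ne (Ne.symm h)]

/-- The edge counts of a walk form a unit flow, and its support leads down to the end of the walk
if a vertex is ranked by how early the walk leaves it for the last time. -/
theorem IsWalk.isUnitFlow_and_descends [DecidableEq ι] {src tgt : ι → σ} {t : σ} (l : List ι) :
    ∀ {s : σ}, IsWalk src tgt s l t → IsUnitFlow src tgt (fun e => l.count e) s t ∧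
      ∃ z, Descends src tgt (fun e => l.count e) t z := by
  induction l with
  | nil =>
    rintro s rfl
    exact ⟨fun v => by simp [flowAt], 0, fun e => .inl (by simp)⟩
  | cons e₀ l ih =>
    rintro s ⟨rfl, hl⟩
    obtain ⟨hf, z, hz⟩ := ih hl
    have hcount : (fun e => (e₀ :: l).count e) = (fun e => l.count e) + Pi.single e₀ 1 := by
      funext e
      by_cases h : e = e₀
      · subst h; simp
      · simp [h, List.count_cons_of_ne (Ne.symm h)]
    rw [hcount]
    refine ⟨isUnitFlow_add_single_iff.2 hf, ?_⟩
    generalize (fun e => l.count e) = f at hf hz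
    have hmono : ∀ e, f e ≤ (f + Pi.single e₀ 1 : ι → ℕ) e := fun e => by simp
    have hne₀ : ∀ e, e ≠ e₀ → (f + Pi.single e₀ 1 : ι → ℕ) e = f e := fun e h => by simp [h]
    by_cases hlast : flowAt src f (src e₀) = 0 ∧ src e₀ ≠ t
    · -- The walk leaves `src e₀` for the last time, so this vertex is re-ranked above `tgt e₀`.
      obtain ⟨hout, hst⟩ := hlast
      have htgt : tgt e₀ ≠ src e₀ := by
        intro h
        have := hf (src e₀)
        simp [hout, hst, h] at this
      have hin : flowAt tgt f (src e₀) = 0 := by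
        have := hf (src e₀)
        simp only [hout, hst, if_false] at this
        omega
      refine ⟨Function.update z (src e₀) (z (tgt e₀) + 1), fun e => ?_⟩
      by_cases hse : src e = src e₀
      · refine .inr (.inr ⟨e₀, hse.symm, by simp, ?_⟩)
        rw [hse, Function.update_self, Function.update_of_ne htgt]
        omega
      · rw [hne₀ e fun h => hse (h ▸ rfl)]
        refine (hz e).imp_right (Or.imp_right ?_)
        rintro ⟨e', h1, h2, h3⟩
        have : tgt e' ≠ src e₀ := fun h => (flowAt_pos_iff.2 ⟨e', h, h2⟩).ne' hin
        refine ⟨e', h1, h2.trans_le (hmono e'), ?_⟩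
        rwa [Function.update_of_ne this, Function.update_of_ne hse]
    · refine ⟨z, fun e => ?_⟩
      have hlift : ∀ {a : σ}, (∃ e', src e' = a ∧ 0 < f e' ∧ z (tgt e') < z a) →
          ∃ e', src e' = a ∧ 0 < (f + Pi.single e₀ 1 : ι → ℕ) e' ∧ z (tgt e') < z a :=
        fun ⟨e', h1, h2, h3⟩ => ⟨e', h1, h2.trans_le (hmono e'), h3⟩
      by_cases hst : src e = t
      · exact .inr (.inl hst)
      by_cases h : e = e₀
      · subst h
        obtain ⟨e₂, h₂, hf₂⟩ := flowAt_pos_iff.1 (Nat.pos_of_ne_zero fun h0 => hlast ⟨h0, hst⟩)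
        rcases hz e₂ with h | h | h
        · omega
        · exact absurd (h₂ ▸ h) hst
        · rw [h₂] at h
          exact .inr (.inr (hlift h))
      · rw [hne₀ e h]
        exact (hz e).imp_right (Or.imp_right hlift)

/-- An Eulerian criterion: `f` counts the edges of some walk from `s` to `t` if and only if it is a
unit flow from `s` to `t` whose support leads down to `t`. -/
theorem exists_walk_count_iff [DecidableEq ι] {src tgt : ι → σ} {f : ι → ℕ} {s t : σ} :
    (∃ l : List ι, IsWalk src tgt s l t ∧ ∀ e, l.count e = f e) ↔
      IsUnitFlow src tgt f s t ∧ ∃ z, Descends src tgt f t z := by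
  constructor
  · rintro ⟨l, hl, hcount⟩
    obtain rfl : (fun e => l.count e) = f := funext hcount
    exact hl.isUnitFlow_and_descends
  · rintro ⟨hf, z, hz⟩
    exact exists_walk_of_isUnitFlow _ f s rfl hf hz

theorem List.sum_map_eq_sum_count [DecidableEq ι] {M : Type*} [AddCommMonoid M] (l : List ι)
    (g : ι → M) : (l.map g).sum = ∑ e, l.count e • g e := by
  rw [Finset.sum_list_map_count]
  refine Finset.sum_subset (Finset.subset_univ _) fun e _ he => ?_
  rw [List.count_eq_zero_of_not_mem (by simpa using he), zero_smul]

/-- The edge counts of the walks between two vertices of a finite graph form a semilinear set: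
whether a support leads down to `t` depends only on the support, and once the support is fixed,
the unit flows are the solutions of a linear system. -/
theorem isSemilinearSet_walk_counts [DecidableEq ι] [Finite σ] (src tgt : ι → σ) (s t : σ) :
    IsSemilinearSet {f : ι → ℕ | ∃ l : List ι, IsWalk src tgt s l t ∧ ∀ e, l.count e = f e} := by
  have hzero : ∀ e, IsSemilinearSet {f : ι → ℕ | f e = 0} := fun e => by
    simpa using isSemilinearSet_setOfPred_eq 0 0 (Pi.evalAddMonoidHom (fun _ : ι => ℕ) e)
      (0 : (ι → ℕ) →+ ℕ)
  have hflow : IsSemilinearSet {f : ι → ℕ | IsUnitFlow src tgt f s t} := by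
    let F (end_ : ι → σ) (v : σ) : (ι → ℕ) →+ ℕ :=
      ∑ e, if end_ e = v then Pi.evalAddMonoidHom (fun _ : ι => ℕ) e else 0
    have hF : ∀ end_ v f, F end_ v f = flowAt end_ f v := fun end_ v f => by
      simp only [F, AddMonoidHom.finsetSum_apply, flowAt]
      refine Finset.sum_congr rfl fun e _ => ?_
      split_ifs <;> rfl
    have : {f : ι → ℕ | IsUnitFlow src tgt f s t} = ⋂ v, {f | (if v = s then 1 else 0) + F tgt v f =
        (if v = t then 1 else 0) + F src v f} := by
      ext f
      simp only [Set.mem_ofPred_eq, Set.mem_iInter, hF, IsUnitFlow]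
      exact forall_congr' fun v => by omega
    rw [this]
    exact .iInter fun v => isSemilinearSet_setOfPred_eq _ _ _ _
  let D : Set (Set ι) := {A | ∃ z : σ → ℤ, ∀ e ∈ A, src e = t ∨
    ∃ e', src e' = src e ∧ e' ∈ A ∧ z (tgt e') < z (src e)}
  have : {f : ι → ℕ | ∃ l : List ι, IsWalk src tgt s l t ∧ ∀ e, l.count e = f e} =
      ⋃ A ∈ D, {f | IsUnitFlow src tgt f s t} ∩
        ((⋂ e ∈ A, {f | f e = 0}ᶜ) ∩ ⋂ e ∈ Aᶜ, {f | f e = 0}) := by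
    ext f
    simp only [Set.mem_ofPred_eq, exists_walk_count_iff, Set.mem_iUnion, Set.mem_inter_iff,
      Set.mem_iInter, Set.mem_compl_iff, exists_prop]
    constructor
    · rintro ⟨hf, z, hz⟩
      refine ⟨{e | f e ≠ 0}, ⟨z, fun e he => ?_⟩, hf, fun e he => he, fun e he => by simpa using he⟩
      simpa [Nat.pos_iff_ne_zero] using (hz e).resolve_left he
    · rintro ⟨A, ⟨z, hz⟩, hf, h1, h2⟩
      refine ⟨hf, z, fun e => or_iff_not_imp_left.2 fun he => ?_⟩
      refine (hz e (by_contra fun h => he (h2 e h))).imp_right ?_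
      exact fun ⟨e', h, h', h''⟩ => ⟨e', h, Nat.pos_of_ne_zero (h1 e' h'), h''⟩
  rw [this]
  exact .biUnion (Set.toFinite _) fun A _ => hflow.inter <|
    (IsSemilinearSet.biInter (Set.toFinite _) fun e _ => (hzero e).compl).inter
      (IsSemilinearSet.biInter (Set.toFinite _) fun e _ => hzero e)

end Walk

/-! ### Reachability as walks in the product of the control graph with the matrix monoid -/

section Product

variable {d : ℕ} {Q : Type u}

/-- `(τ i, N i)` enumerates, possibly with repetitions, the edges of the product graph: pairs of a
transition `t` and of an element `N` of the matrix monoid. The edge `(t, N)` leads from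
`(t.src, N * t.mat)` to `(t.tgt, N)` and stands for taking `t` when `N` is the product of the
matrices still to be applied; it contributes `N * t.vec` to the final vector. -/
structure ProductEdges {ι : Type*} (V : AffineZVASS d Q) (τ : ι → AffTransition d Q)
    (N : ι → Matrix (Fin d) (Fin d) ℤ) : Prop where
  mem_T : ∀ i, τ i ∈ V.T
  mem_monoid : ∀ i, N i ∈ V.monoid
  exists_eq : ∀ t ∈ V.T, ∀ A ∈ V.monoid, ∃ i, τ i = t ∧ N i = A

variable {ι : Type*} {V : AffineZVASS d Q} {τ : ι → AffTransition d Q}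
  {N : ι → Matrix (Fin d) (Fin d) ℤ}

/-- The source of a product edge. -/
def prodSrc (τ : ι → AffTransition d Q) (N : ι → Matrix (Fin d) (Fin d) ℤ) (i : ι) :
    Q × Matrix (Fin d) (Fin d) ℤ := ((τ i).src, N i * (τ i).mat)

/-- The target of a product edge. -/
def prodTgt (τ : ι → AffTransition d Q) (N : ι → Matrix (Fin d) (Fin d) ℤ) (i : ι) :
    Q × Matrix (Fin d) (Fin d) ℤ := ((τ i).tgt, N i)

/-- The contribution of a product edge to the final vector. -/
def prodVec (τ : ι → AffTransition d Q) (N : ι → Matrix (Fin d) (Fin d) ℤ) (i : ι) : Fin d → ℤ :=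
  (N i).mulVec (τ i).vec

theorem AffineZVASS.mat_mem_monoid {t : AffTransition d Q} (ht : t ∈ V.T) : t.mat ∈ V.monoid :=
  Submonoid.subset_closure ⟨t, ht, rfl⟩

theorem ProductEdges.src_mem (h : ProductEdges V τ N) (i : ι) :
    (prodSrc τ N i).2 ∈ V.monoid :=
  V.monoid.mul_mem (h.mem_monoid i) (AffineZVASS.mat_mem_monoid (h.mem_T i))

theorem ProductEdges.exists_walk_of_reach (h : ProductEdges V τ N) {q : Q} {v : Fin d → ℤ}
    {c : Q × (Fin d → ℤ)} (hc : V.Reach c (q, v)) :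
    ∃ M ∈ V.monoid, ∃ l, IsWalk (prodSrc τ N) (prodTgt τ N) (c.1, M) l (q, 1) ∧
      v = M.mulVec c.2 + (l.map (prodVec τ N)).sum := by
  induction hc using Relation.ReflTransGen.head_induction_on with
  | refl => exact ⟨1, V.monoid.one_mem, [], rfl, by simp⟩
  | head hstep _ ih =>
    obtain ⟨t, ht, hsrc, htgt, hvec⟩ := hstep
    obtain ⟨M, hM, l, hl, hv⟩ := ih
    obtain ⟨i, rfl, rfl⟩ := h.exists_eq t ht M hM
    refine ⟨N i * (τ i).mat, V.monoid.mul_mem hM (AffineZVASS.mat_mem_monoid ht), i :: l,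
      ⟨by rw [prodSrc, hsrc], ?_⟩, ?_⟩
    · rwa [prodTgt, ← htgt]
    · rw [hv, hvec, List.map_cons, List.sum_cons, Matrix.mulVec_add, Matrix.mulVec_mulVec, prodVec,
        add_assoc]

theorem ProductEdges.reach_of_walk (h : ProductEdges V τ N) {q : Q} (l : List ι) :
    ∀ {p : Q} {M : Matrix (Fin d) (Fin d) ℤ} {u : Fin d → ℤ},
      IsWalk (prodSrc τ N) (prodTgt τ N) (p, M) l (q, 1) →
      V.Reach (p, u) (q, M.mulVec u + (l.map (prodVec τ N)).sum) := by
  induction l with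
  | nil =>
    intro p M u hl
    obtain ⟨rfl, rfl⟩ := Prod.mk.inj hl
    have : V.Reach (p, u) (p, u) := Relation.ReflTransGen.refl
    simpa using this
  | cons i l ih =>
    rintro p M u ⟨hi, hl⟩
    obtain ⟨rfl, rfl⟩ := Prod.mk.inj hi
    refine .head (b := ((τ i).tgt, (τ i).mat.mulVec u + (τ i).vec))
      ⟨τ i, h.mem_T i, rfl, rfl, rfl⟩ ?_
    rw [List.map_cons, List.sum_cons, ← add_assoc, ← Matrix.mulVec_mulVec, prodVec,
      ← Matrix.mulVec_add]
    exact ih hl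

theorem ProductEdges.reach_iff (h : ProductEdges V τ N) {p q : Q} {u v : Fin d → ℤ} :
    V.Reach (p, u) (q, v) ↔ ∃ M ∈ V.monoid, ∃ l,
      IsWalk (prodSrc τ N) (prodTgt τ N) (p, M) l (q, 1) ∧
        v = M.mulVec u + (l.map (prodVec τ N)).sum := by
  refine ⟨h.exists_walk_of_reach, ?_⟩
  rintro ⟨M, -, l, hl, rfl⟩
  exact h.reach_of_walk l hl

theorem ProductEdges.isSemilinearSet_reach [Finite Q] [Fintype ι] (h : ProductEdges V τ N)
    (hV : V.FiniteMonoid) (p q : Q) :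
    IsSemilinearSet {w : (Fin d → ℤ) × (Fin d → ℤ) | V.Reach (p, w.1) (q, w.2)} := by
  classical
  have : Finite V.monoid := hV
  let src (i : ι) : Q × V.monoid := ((τ i).src, ⟨(prodSrc τ N i).2, h.src_mem i⟩)
  let tgt (i : ι) : Q × V.monoid := ((τ i).tgt, ⟨N i, h.mem_monoid i⟩)
  -- the final vector as an additive function of the edge counts and of the initial vector
  let F (M : V.monoid) : (ι → ℕ) × (Fin d → ℤ) →+
      (Fin d → ℤ) × (Fin d → ℤ) :=
    AddMonoidHom.prod (AddMonoidHom.snd _ _) ((Matrix.mulVecLin M.1).toAddMonoidHom.comp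
      (AddMonoidHom.snd _ _) +
        (∑ i, ((smulAddHom ℕ (Fin d → ℤ)).flip (prodVec τ N i)).comp
          (Pi.evalAddMonoidHom (fun _ => ℕ) i)).comp (AddMonoidHom.fst _ _))
  have hF : ∀ M f x, F M (f, x) = (x, M.1.mulVec x + ∑ i, f i • prodVec τ N i) := by
    intro M f x
    simp [F]
  have key : {w : (Fin d → ℤ) × (Fin d → ℤ) | V.Reach (p, w.1) (q, w.2)} =
      ⋃ M : V.monoid, F M '' (AddMonoidHom.fst _ _ ⁻¹'
        {f : ι → ℕ | ∃ l, IsWalk src tgt (p, M) l (q, 1) ∧ ∀ e, l.count e = f e}) := by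
    have hwalk : ∀ (M : V.monoid) l, IsWalk src tgt (p, M) l (q, 1) ↔
        IsWalk (prodSrc τ N) (prodTgt τ N) (p, M.1) l (q, 1) := by
      intro M l
      have hinj : Function.Injective (Prod.map id Subtype.val : Q × V.monoid → _) :=
        Function.injective_id.prodMap Subtype.val_injective
      exact (IsWalk.map_iff (src := src) (tgt := tgt) (hinj.injOn (s := Set.univ))
        (fun _ => trivial) (fun _ => trivial) trivial l trivial).symm
    ext ⟨u, v⟩
    simp only [Set.mem_ofPred_eq, h.reach_iff, Set.mem_iUnion, Set.mem_image, Set.mem_preimage,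
      Prod.exists, hF, hwalk, AddMonoidHom.coe_fst, Prod.mk.injEq]
    constructor
    · rintro ⟨M, hM, l, hl, rfl⟩
      exact ⟨⟨M, hM⟩, fun e => l.count e, u, ⟨l, hl, fun _ => rfl⟩, rfl, by
        rw [List.sum_map_eq_sum_count]⟩
    · rintro ⟨M, f, x, ⟨l, hl, hcount⟩, rfl, rfl⟩
      exact ⟨M, M.2, l, hl, by simp only [List.sum_map_eq_sum_count, hcount]⟩
  rw [key]
  exact .iUnion fun M => ((isSemilinearSet_walk_counts src tgt _ _).preimage _).image (F M)

end Product

/-- The reachability relation of an affine `ℤ`-VASS with the finite-monoid property is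
semilinear. -/
theorem AffineZVASS.isSemilinearSet_reach {d : ℕ} {Q : Type u} [Finite Q] (V : AffineZVASS d Q)
    (hV : V.FiniteMonoid) (p q : Q) :
    IsSemilinearSet {w : (Fin d → ℤ) × (Fin d → ℤ) | V.Reach (p, w.1) (q, w.2)} := by
  have : Finite V.monoid := hV
  have := Fintype.ofFinite V.monoid
  have hE : ProductEdges V (fun i : V.T × V.monoid => i.1.1) (fun i => i.2.1) :=
    ⟨fun i => i.1.2, fun i => i.2.2, fun t ht A hA => ⟨(⟨t, ht⟩, ⟨A, hA⟩), rfl, rfl⟩⟩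
  exact hE.isSemilinearSet_reach hV p q

/-! ### Primitive recursive functions on lists and integers

The composition lemmas below are stated in the form that `fun_prop` needs, so that it proves that a
function written with these operations is primitive recursive. -/

attribute [fun_prop] Primrec
attribute [fun_prop] Primrec.pair

namespace Primrec

variable {α β γ σ : Type*} [Primcodable α] [Primcodable β] [Primcodable γ] [Primcodable σ]

@[fun_prop]
theorem fun_id : Primrec fun a : α => a := Primrec.id

@[fun_prop]
theorem fun_const (x : σ) : Primrec fun _ : α => x := Primrec.const x

@[fun_prop]
theorem fun_comp {f : β → σ} {g : α → β} (hf : Primrec f) (hg : Primrec g) :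
    Primrec fun a => f (g a) := hf.comp hg

@[fun_prop]
theorem fun_fst {f : α → β × γ} (hf : Primrec f) : Primrec fun a => (f a).1 := fst.comp hf

@[fun_prop]
theorem fun_snd {f : α → β × γ} (hf : Primrec f) : Primrec fun a => (f a).2 := snd.comp hf

@[fun_prop]
theorem fun_nat_add {f g : α → ℕ} (hf : Primrec f) (hg : Primrec g) :
    Primrec fun a => f a + g a := nat_add.comp hf hg

@[fun_prop]
theorem fun_nat_sub {f g : α → ℕ} (hf : Primrec f) (hg : Primrec g) :
    Primrec fun a => f a - g a := nat_sub.comp hf hg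

@[fun_prop]
theorem fun_nat_mul {f g : α → ℕ} (hf : Primrec f) (hg : Primrec g) :
    Primrec fun a => f a * g a := nat_mul.comp hf hg

@[fun_prop]
theorem fun_nat_div {f g : α → ℕ} (hf : Primrec f) (hg : Primrec g) :
    Primrec fun a => f a / g a := nat_div.comp hf hg

@[fun_prop]
theorem fun_nat_mod {f g : α → ℕ} (hf : Primrec f) (hg : Primrec g) :
    Primrec fun a => f a % g a := nat_mod.comp hf hg

@[fun_prop]
theorem fun_nat_pow {f g : α → ℕ} (hf : Primrec f) (hg : Primrec g) :
    Primrec fun a => f a ^ g a := (Primrec₂.unpaired'.1 Nat.Primrec.pow).comp hf hg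

@[fun_prop]
theorem fun_cons {f : α → β} {g : α → List β} (hf : Primrec f) (hg : Primrec g) :
    Primrec fun a => f a :: g a := list_cons.comp hf hg

@[fun_prop]
theorem fun_append {f g : α → List β} (hf : Primrec f) (hg : Primrec g) :
    Primrec fun a => f a ++ g a := list_append.comp hf hg

@[fun_prop]
theorem fun_range {f : α → ℕ} (hf : Primrec f) : Primrec fun a => List.range (f a) :=
  list_range.comp hf

@[fun_prop]
theorem fun_length {f : α → List β} (hf : Primrec f) : Primrec fun a => (f a).length :=
  list_length.comp hf

@[fun_prop]
theorem fun_flatten {f : α → List (List β)} (hf : Primrec f) : Primrec fun a => (f a).flatten :=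
  list_flatten.comp hf

@[fun_prop]
theorem fun_getD {f : α → List β} {g : α → ℕ} {x : β} (hf : Primrec f) (hg : Primrec g) :
    Primrec fun a => (f a).getD (g a) x := (list_getD x).comp hf hg

@[fun_prop]
theorem fun_idxOf [BEq β] [LawfulBEq β] {f : α → β} {g : α → List β} (hf : Primrec f)
    (hg : Primrec g) : Primrec fun a => (g a).idxOf (f a) := by
  classical
  have h : ‹BEq β› = instBEqOfDecidableEq := lawful_beq_subsingleton _ _
  subst h
  exact list_idxOf.comp hf hg

@[fun_prop]
theorem fun_map {f : α → List β} {g : α → β → σ} (hf : Primrec f)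
    (hg : Primrec fun p : α × β => g p.1 p.2) : Primrec fun a => (f a).map (g a) :=
  list_map hf hg

@[fun_prop]
theorem fun_flatMap {f : α → List β} {g : α → β → List σ} (hf : Primrec f)
    (hg : Primrec fun p : α × β => g p.1 p.2) : Primrec fun a => (f a).flatMap (g a) :=
  list_flatMap hf hg

@[fun_prop]
theorem fun_foldl {f : α → List β} {g : α → σ} {h : α → σ → β → σ} (hf : Primrec f)
    (hg : Primrec g) (hh : Primrec fun p : α × σ × β => h p.1 p.2.1 p.2.2) :
    Primrec fun a => (f a).foldl (h a) (g a) :=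
  list_foldl (h := fun a p => h a p.1 p.2) hf hg hh

@[fun_prop]
theorem fun_foldr {f : α → List β} {g : α → σ} {h : α → β → σ → σ} (hf : Primrec f)
    (hg : Primrec g) (hh : Primrec fun p : α × β × σ => h p.1 p.2.1 p.2.2) :
    Primrec fun a => (f a).foldr (h a) (g a) :=
  list_foldr (h := fun a p => h a p.1 p.2) hf hg hh

@[fun_prop]
theorem fun_iterate {f : α → ℕ} {g : α → β} {h : α → β → β} (hf : Primrec f) (hg : Primrec g)
    (hh : Primrec fun p : α × β => h p.1 p.2) : Primrec fun a => (h a)^[f a] (g a) :=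
  nat_iterate hf hg hh

@[fun_prop]
theorem fun_ite_eq [DecidableEq β] {f g : α → β} {x y : α → σ} (hf : Primrec f) (hg : Primrec g)
    (hx : Primrec x) (hy : Primrec y) : Primrec fun a => if f a = g a then x a else y a :=
  ite (PrimrecRel.comp Primrec.eq hf hg) hx hy

@[fun_prop]
theorem fun_ite_le {f g : α → ℕ} {x y : α → σ} (hf : Primrec f) (hg : Primrec g)
    (hx : Primrec x) (hy : Primrec y) : Primrec fun a => if f a ≤ g a then x a else y a :=
  ite (nat_le.comp hf hg) hx hy

@[fun_prop]
theorem fun_decide_eq [DecidableEq β] {f g : α → β} (hf : Primrec f) (hg : Primrec g) :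
    Primrec fun a => decide (f a = g a) :=
  (fun_ite_eq hf hg (fun_const true) (fun_const false)).of_eq fun a => by
    by_cases h : f a = g a <;> simp [h]

@[fun_prop]
theorem fun_nat_sum {f : α → List ℕ} (hf : Primrec f) : Primrec fun a => (f a).sum := by
  simp only [List.sum_eq_foldr]
  fun_prop

theorem encode_int (z : ℤ) :
    Encodable.encode z = if 0 ≤ z then 2 * z.toNat else 2 * (-z).toNat - 1 := by
  cases z with
  | ofNat n => rfl
  | negSucc n => rfl

@[fun_prop]
theorem int_toNat {f : α → ℤ} (hf : Primrec f) : Primrec fun a => (f a).toNat := by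
  have h : Primrec fun a => Encodable.encode (f a) := Primrec.encode.comp hf
  have : Primrec fun a =>
      if Encodable.encode (f a) % 2 = 0 then Encodable.encode (f a) / 2 else 0 := by fun_prop
  refine this.of_eq fun a => ?_
  rw [encode_int]
  split_ifs <;> omega

@[fun_prop]
theorem int_neg_toNat {f : α → ℤ} (hf : Primrec f) : Primrec fun a => (-f a).toNat := by
  have h : Primrec fun a => Encodable.encode (f a) := Primrec.encode.comp hf
  have : Primrec fun a =>
      if Encodable.encode (f a) % 2 = 1 then Encodable.encode (f a) / 2 + 1 else 0 := by fun_prop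
  refine this.of_eq fun a => ?_
  rw [encode_int]
  split_ifs <;> omega

@[fun_prop]
theorem int_natAbs {f : α → ℤ} (hf : Primrec f) : Primrec fun a => (f a).natAbs := by
  have : Primrec fun a => (f a).toNat + (-f a).toNat := by fun_prop
  exact this.of_eq fun a => by omega

theorem int_sub_natCast {f g : α → ℕ} (hf : Primrec f) (hg : Primrec g) :
    Primrec fun a => (f a : ℤ) - (g a : ℤ) := by
  rw [← encode_iff]
  have : Primrec fun a => if g a ≤ f a then 2 * (f a - g a) else 2 * (g a - f a) - 1 := by fun_prop
  refine this.of_eq fun a => ?_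
  rw [encode_int]
  split_ifs <;> omega

@[fun_prop]
theorem int_add {f g : α → ℤ} (hf : Primrec f) (hg : Primrec g) :
    Primrec fun a => f a + g a := by
  have := int_sub_natCast (f := fun a => (f a).toNat + (g a).toNat)
    (g := fun a => (-f a).toNat + (-g a).toNat) (by fun_prop) (by fun_prop)
  exact this.of_eq fun a => by omega

@[fun_prop]
theorem int_mul {f g : α → ℤ} (hf : Primrec f) (hg : Primrec g) :
    Primrec fun a => f a * g a := by
  have := int_sub_natCast
    (f := fun a => (f a).toNat * (g a).toNat + (-f a).toNat * (-g a).toNat)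
    (g := fun a => (f a).toNat * (-g a).toNat + (-f a).toNat * (g a).toNat)
    (by fun_prop) (by fun_prop)
  refine this.of_eq fun a => ?_
  have key : ∀ x : ℤ, x = (x.toNat : ℤ) - ((-x).toNat : ℤ) := fun x => by omega
  conv_rhs => rw [key (f a), key (g a)]
  push_cast
  ring

@[fun_prop]
theorem fun_int_sum {f : α → List ℤ} (hf : Primrec f) : Primrec fun a => (f a).sum := by
  simp only [List.sum_eq_foldr]
  fun_prop

@[fun_prop]
theorem nat_size {f : α → ℕ} (hf : Primrec f) : Primrec fun a => (f a).size := by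
  have : Primrec fun a => ((List.range (f a)).map fun k => if 2 ^ k ≤ f a then 1 else 0).sum := by
    fun_prop
  refine this.of_eq fun a => ?_
  -- among the `k < n`, exactly the `k < n.size` satisfy `2 ^ k ≤ n`
  have h : ∀ m s : ℕ, ((List.range m).map fun k => if k < s then 1 else 0).sum = min m s := by
    intro m s
    induction m with
    | zero => simp
    | succ m ih =>
      rw [List.range_succ, List.map_append, List.sum_append, ih, List.map_singleton,
        List.sum_singleton]
      split_ifs <;> omega
  simp only [← Nat.lt_size, h]
  exact min_eq_right (Nat.size_le.2 Nat.lt_two_pow_self)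

end Primrec

/-! ### Systems of linear inequalities as existential Presburger formulas -/

/-- A linear term, as the list of its summands `(k, i)`: the free variable `u_i` if `k = 0`, the
free variable `v_i` if `k = 1`, the bound variable number `i` if `k = 2`, and the constant `1`
otherwise. -/
abbrev LinTerm : Type := List (ℕ × ℕ)

/-- The inequality `l ≤ r` between two linear terms, as the pair `(l, r)`. -/
abbrev LinIneq : Type := LinTerm × LinTerm

/-- A disjunction of conjunctions of disjunctions of conjunctions of linear inequalities. -/
abbrev LinSystem : Type := List (List (List (List LinIneq)))

/-- The value of a linear term when `ρ k i` is the value of the summand `(k, i)`. -/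
def LinTerm.eval (ρ : ℕ → ℕ → ℤ) (l : LinTerm) : ℤ := (l.map fun x => ρ x.1 x.2).sum

/-- `ρ` satisfies the system. -/
def LinSystem.Sat (ρ : ℕ → ℕ → ℤ) (C : LinSystem) : Prop :=
  ∃ a ∈ C, ∀ b ∈ a, ∃ c ∈ b, ∀ i ∈ c, LinTerm.eval ρ i.1 ≤ LinTerm.eval ρ i.2

/-- An integer vector, extended by zero to all natural indices. -/
def extend {d : ℕ} (u : Fin d → ℤ) (i : ℕ) : ℤ := if h : i < d then u ⟨i, h⟩ else 0

/-- The values of the summands of linear terms, given the values of the variables. -/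
def assignment (u v w : ℕ → ℤ) : ℕ → ℕ → ℤ
  | 0 => u
  | 1 => v
  | 2 => w
  | _ => fun _ => 1

/-- The indices in the term are in range for `d` free variables of either kind and `n` bound
variables. -/
def LinTerm.InRange (d n : ℕ) (l : LinTerm) : Prop :=
  ∀ x ∈ l, (x.1 < 2 → x.2 < d) ∧ (x.1 = 2 → x.2 < n)

/-- The indices in the system are in range. -/
def LinSystem.InRange (d n : ℕ) (C : LinSystem) : Prop :=
  ∀ a ∈ C, ∀ b ∈ a, ∀ c ∈ b, ∀ i ∈ c, LinTerm.InRange d n i.1 ∧ LinTerm.InRange d n i.2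

/-- Only the values of the variables in range matter. -/
theorem LinSystem.InRange.sat_congr {d n : ℕ} {C : LinSystem} (hC : C.InRange d n)
    {u v w u' v' w' : ℕ → ℤ} (hu : ∀ i < d, u i = u' i) (hv : ∀ i < d, v i = v' i)
    (hw : ∀ i < n, w i = w' i) :
    C.Sat (assignment u v w) ↔ C.Sat (assignment u' v' w') := by
  have hterm : ∀ l : LinTerm, l.InRange d n →
      l.eval (assignment u v w) = l.eval (assignment u' v' w') := by
    intro l hl
    refine congrArg List.sum (List.map_congr_left fun x hx => ?_)
    obtain ⟨h1, h2⟩ := hl x hx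
    rcases x with ⟨_ | _ | _ | k, i⟩
    · exact hu i (h1 (by simp))
    · exact hv i (h1 (by simp))
    · exact hw i (h2 rfl)
    · rfl
  refine exists_congr fun a => and_congr_right fun ha => ?_
  refine forall₂_congr fun b hb => exists_congr fun c => and_congr_right fun hc => ?_
  refine forall₂_congr fun i hi => ?_
  obtain ⟨h1, h2⟩ := hC a ha b hb c hc i hi
  rw [hterm _ h1, hterm _ h2]

namespace Presburger

/-- The terms of Presburger arithmetic with free variables `u_i`, `v_i` (`i < d`) and `n` bound
variables. -/
abbrev PTerm (d n : ℕ) : Type := presburgerOrd.Term ((Fin d ⊕ Fin d) ⊕ Fin n)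

/-- The formulas of Presburger arithmetic over the variables of `PTerm d n`. -/
abbrev PForm (d n : ℕ) : Type := presburgerOrd.BoundedFormula (Fin d ⊕ Fin d) n

variable {d n : ℕ}

/-- The constant `0`. -/
def zeroTerm : PTerm d n := .func (Sum.inl presburgerFunc.zero : presburgerOrd.Functions 0) ![]

/-- The constant `1`. -/
def oneTerm : PTerm d n := .func (Sum.inl presburgerFunc.one : presburgerOrd.Functions 0) ![]

/-- The sum of two terms. -/
def addTerm (a b : PTerm d n) : PTerm d n :=
  .func (Sum.inl presburgerFunc.add : presburgerOrd.Functions 2) ![a, b]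

/-- A summand of a linear term; summands out of range become `0`. -/
def summand (x : ℕ × ℕ) : PTerm d n :=
  if x.1 = 0 then (if h : x.2 < d then .var (.inl (.inl ⟨x.2, h⟩)) else zeroTerm)
  else if x.1 = 1 then (if h : x.2 < d then .var (.inl (.inr ⟨x.2, h⟩)) else zeroTerm)
  else if x.1 = 2 then (if h : x.2 < n then .var (.inr ⟨x.2, h⟩) else zeroTerm)
  else oneTerm

/-- A linear term as a term of Presburger arithmetic. -/
def linTerm (l : LinTerm) : PTerm d n := l.foldr (fun x t => addTerm (summand x) t) zeroTerm

/-- A linear inequality as an atomic formula. -/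
def linIneq (i : LinIneq) : PForm d n :=
  .rel (Sum.inr Language.orderRel.le : presburgerOrd.Relations 2) ![linTerm i.1, linTerm i.2]

/-- The conjunction of a list of formulas, as `¬ (φ₁ → φ₂ → … → ⊥)`. -/
def conj (l : List (PForm d n)) : PForm d n :=
  .imp (l.foldr (fun φ ψ => φ.imp ψ) .falsum) .falsum

/-- The disjunction of a list of formulas, as `¬ φ₁ → ¬ φ₂ → … → ⊥`. -/
def disj (l : List (PForm d n)) : PForm d n :=
  l.foldr (fun φ ψ => (φ.imp .falsum).imp ψ) .falsum

/-- A system of linear inequalities as a quantifier-free formula. -/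
def linBody (C : LinSystem) : PForm d n :=
  disj (C.map fun a => conj (a.map fun b => disj (b.map fun c => conj (c.map linIneq))))

/-- A system of linear inequalities as an existential formula with `n` bound variables. -/
def linFormula (d n : ℕ) (C : LinSystem) : presburgerOrd.Formula (Fin d ⊕ Fin d) :=
  (linBody C : PForm d n).exs

/-! ### Semantics of these formulas -/

theorem isQF_conj {l : List (PForm d n)} (h : ∀ φ ∈ l, φ.IsQF) : (conj l).IsQF := by
  refine .imp ?_ .falsum
  induction l with
  | nil => exact .falsum
  | cons φ l ih =>
    exact .imp (h φ (by simp)) (ih fun ψ hψ => h ψ (by simp [hψ]))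

theorem isQF_disj {l : List (PForm d n)} (h : ∀ φ ∈ l, φ.IsQF) : (disj l).IsQF := by
  induction l with
  | nil => exact .falsum
  | cons φ l ih =>
    exact .imp (.imp (h φ (by simp)) .falsum) (ih fun ψ hψ => h ψ (by simp [hψ]))

theorem isQF_linBody (C : LinSystem) : (linBody C : PForm d n).IsQF := by
  refine isQF_disj fun φ hφ => ?_
  obtain ⟨a, -, rfl⟩ := List.mem_map.1 hφ
  refine isQF_conj fun φ hφ => ?_
  obtain ⟨b, -, rfl⟩ := List.mem_map.1 hφ
  refine isQF_disj fun φ hφ => ?_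
  obtain ⟨c, -, rfl⟩ := List.mem_map.1 hφ
  refine isQF_conj fun φ hφ => ?_
  obtain ⟨i, -, rfl⟩ := List.mem_map.1 hφ
  exact (Language.BoundedFormula.IsAtomic.rel _ _).isQF

theorem isExistential_exs : ∀ {n : ℕ} {φ : PForm d n}, φ.IsExistential → φ.exs.IsExistential
  | 0, _, h => h
  | _ + 1, φ, h => isExistential_exs (φ := φ.ex) h.ex

theorem isExistential_linFormula (C : LinSystem) : (linFormula d n C).IsExistential :=
  isExistential_exs (isQF_linBody C).isExistential

variable {u v : Fin d → ℤ} {w : Fin n → ℤ}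

theorem realize_addTerm (a b : PTerm d n) (ρ : (Fin d ⊕ Fin d) ⊕ Fin n → ℤ) :
    (addTerm a b).realize ρ = a.realize ρ + b.realize ρ := rfl

theorem realize_summand (x : ℕ × ℕ) :
    (summand x : PTerm d n).realize (Sum.elim (Sum.elim u v) w) =
      assignment (extend u) (extend v) (extend w) x.1 x.2 := by
  have h0 : ∀ ρ, (zeroTerm : PTerm d n).realize ρ = (0 : ℤ) := fun ρ => rfl
  have h1 : ∀ ρ, (oneTerm : PTerm d n).realize ρ = (1 : ℤ) := fun ρ => rfl
  rcases x with ⟨_ | _ | _ | k, i⟩ <;> simp only [summand, assignment, extend]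
  · by_cases h : i < d <;> simp [h, h0]
  · by_cases h : i < d <;> simp [h, h0]
  · by_cases h : i < n <;> simp [h, h0]
  · simp [h1]

theorem realize_linTerm (l : LinTerm) :
    (linTerm l : PTerm d n).realize (Sum.elim (Sum.elim u v) w) =
      l.eval (assignment (extend u) (extend v) (extend w)) := by
  induction l with
  | nil => rfl
  | cons x l ih =>
    rw [linTerm, List.foldr_cons, realize_addTerm, realize_summand, ← linTerm, ih, LinTerm.eval,
      LinTerm.eval, List.map_cons, List.sum_cons]

theorem realize_linIneq (i : LinIneq) :
    (linIneq i : PForm d n).Realize (Sum.elim u v) w ↔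
      LinTerm.eval (assignment (extend u) (extend v) (extend w)) i.1 ≤
        LinTerm.eval (assignment (extend u) (extend v) (extend w)) i.2 := by
  rw [← realize_linTerm, ← realize_linTerm]
  rfl

theorem realize_conj {ρ : Fin d ⊕ Fin d → ℤ} (l : List (PForm d n)) :
    (conj l).Realize ρ w ↔ ∀ φ ∈ l, φ.Realize ρ w := by
  have : (l.foldr (fun φ ψ => φ.imp ψ) .falsum : PForm d n).Realize ρ w ↔
      ¬ ∀ φ ∈ l, φ.Realize ρ w := by
    induction l with
    | nil => simp [Language.BoundedFormula.Realize]
    | cons φ l ih => simp only [List.foldr_cons, Language.BoundedFormula.realize_imp, ih,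
        List.forall_mem_cons, not_and]
  rw [conj, Language.BoundedFormula.realize_imp, this]
  simp [Language.BoundedFormula.Realize]

theorem realize_disj {ρ : Fin d ⊕ Fin d → ℤ} (l : List (PForm d n)) :
    (disj l).Realize ρ w ↔ ∃ φ ∈ l, φ.Realize ρ w := by
  induction l with
  | nil => simp [disj, Language.BoundedFormula.Realize]
  | cons φ l ih =>
    rw [disj, List.foldr_cons, Language.BoundedFormula.realize_imp, ← disj, ih,
      List.exists_mem_cons_iff]
    exact or_iff_not_imp_left.symm

theorem realize_linBody (C : LinSystem) :
    (linBody C : PForm d n).Realize (Sum.elim u v) w ↔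
      C.Sat (assignment (extend u) (extend v) (extend w)) := by
  simp only [linBody, realize_disj, realize_conj, realize_linIneq, List.mem_map,
    forall_exists_index, and_imp, forall_apply_eq_imp_iff₂, exists_exists_and_eq_and, LinSystem.Sat]

theorem realize_linFormula {C : LinSystem} (hC : C.InRange d n) :
    (linFormula d n C).Realize (Sum.elim u v) ↔
      ∃ w : ℕ → ℤ, C.Sat (assignment (extend u) (extend v) w) := by
  rw [linFormula, Language.BoundedFormula.realize_exs]
  simp only [realize_linBody]
  constructor
  · rintro ⟨w, hw⟩
    exact ⟨_, hw⟩
  · rintro ⟨w, hw⟩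
    refine ⟨fun i => w i, (hC.sat_congr (fun _ _ => rfl) (fun _ _ => rfl) fun i hi => ?_).1 hw⟩
    simp [extend, hi]

/-! ### Writing out these formulas -/

/-- The tokens of a summand. -/
def summandTokens (x : ℕ × ℕ) : List ℕ :=
  if x.1 = 0 then [8, x.2] else if x.1 = 1 then [9, x.2] else if x.1 = 2 then [10, x.2] else [6]

/-- The tokens of a linear term. -/
def linTermTokens (l : LinTerm) : List ℕ := (l.flatMap fun x => 7 :: summandTokens x) ++ [5]

/-- The tokens of a linear inequality. -/
def linIneqTokens (i : LinIneq) : List ℕ := 2 :: (linTermTokens i.1 ++ linTermTokens i.2)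

/-- The tokens of a conjunction of linear inequalities. -/
def conjTokens (c : List LinIneq) : List ℕ :=
  3 :: ((c.flatMap fun i => 3 :: linIneqTokens i) ++ [0, 0])

/-- The tokens of a disjunction of conjunctions. -/
def disjConjTokens (b : List (List LinIneq)) : List ℕ :=
  (b.flatMap fun c => 3 :: 3 :: (conjTokens c ++ [0])) ++ [0]

/-- The tokens of a conjunction of disjunctions of conjunctions. -/
def conjDisjConjTokens (a : List (List (List LinIneq))) : List ℕ :=
  3 :: ((a.flatMap fun b => 3 :: disjConjTokens b) ++ [0, 0])

/-- The tokens of a system. -/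
def linBodyTokens (C : LinSystem) : List ℕ :=
  (C.flatMap fun a => 3 :: 3 :: (conjDisjConjTokens a ++ [0])) ++ [0]

/-- The tokens of the existential closure of a system; `∃` is the quantifier `¬ ∀ ¬`. -/
def linFormulaTokens (n : ℕ) (C : LinSystem) : List ℕ :=
  (List.range n).flatMap (fun _ => [3, 4, 3]) ++
    (linBodyTokens C ++ (List.range n).flatMap fun _ => [0, 0])

theorem tokens_conj (l : List (PForm d n)) :
    tokens (conj l) = 3 :: ((l.flatMap fun φ => 3 :: tokens φ) ++ [0, 0]) := by
  have : tokens (l.foldr (fun φ ψ => φ.imp ψ) .falsum : PForm d n) =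
      (l.flatMap fun φ => 3 :: tokens φ) ++ [0] := by
    induction l with
    | nil => rfl
    | cons φ l ih => simp [tokens, ih]
  simp [conj, tokens, this]

theorem tokens_disj (l : List (PForm d n)) :
    tokens (disj l) = (l.flatMap fun φ => 3 :: 3 :: (tokens φ ++ [0])) ++ [0] := by
  induction l with
  | nil => rfl
  | cons φ l ih =>
    rw [disj, List.foldr_cons, ← disj]
    simp [tokens, ih]

theorem termTokens_linTerm {l : LinTerm} (hl : l.InRange d n) :
    termTokens (linTerm l : PTerm d n) = linTermTokens l := by
  induction l with
  | nil => rfl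
  | cons x l ih =>
    have hx : termTokens (summand x : PTerm d n) = summandTokens x := by
      obtain ⟨h1, h2⟩ := hl x (by simp)
      rcases x with ⟨_ | _ | _ | k, i⟩
      · have : i < d := h1 (by simp)
        simp [summand, summandTokens, termTokens, varTokens, this]
      · have : i < d := h1 (by simp)
        simp [summand, summandTokens, termTokens, varTokens, this]
      · have : i < n := h2 rfl
        simp [summand, summandTokens, termTokens, varTokens, this]
      · simp [summand, summandTokens, oneTerm, termTokens, funcToken]
    have ih := ih fun y hy => hl y (by simp [hy])
    rw [linTerm, List.foldr_cons, ← linTerm, addTerm]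
    simp [termTokens, List.ofFn_succ, hx, ih, linTermTokens, funcToken]

theorem tokens_linBody {C : LinSystem} (hC : C.InRange d n) :
    tokens (linBody C : PForm d n) = linBodyTokens C := by
  rw [linBody, tokens_disj, List.flatMap_map, linBodyTokens]
  refine congrArg (· ++ [0]) (List.flatMap_congr fun a ha => ?_)
  refine congrArg (fun s => 3 :: 3 :: (s ++ [0])) ?_
  rw [tokens_conj, List.flatMap_map, conjDisjConjTokens]
  refine congrArg (fun s => 3 :: (s ++ [0, 0])) (List.flatMap_congr fun b hb => ?_)
  refine congrArg (3 :: ·) ?_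
  rw [tokens_disj, List.flatMap_map, disjConjTokens]
  refine congrArg (· ++ [0]) (List.flatMap_congr fun c hc => ?_)
  refine congrArg (fun s => 3 :: 3 :: (s ++ [0])) ?_
  rw [tokens_conj, List.flatMap_map, conjTokens]
  refine congrArg (fun s => 3 :: (s ++ [0, 0])) (List.flatMap_congr fun i hi => ?_)
  refine congrArg (3 :: ·) ?_
  obtain ⟨h1, h2⟩ := hC a ha b hb c hc i hi
  simp [tokens, linIneq, List.ofFn_succ, linIneqTokens, termTokens_linTerm h1,
    termTokens_linTerm h2]

theorem tokens_exs : ∀ {n : ℕ} (φ : PForm d n), tokens φ.exs =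
    (List.range n).flatMap (fun _ => [3, 4, 3]) ++
      (tokens φ ++ (List.range n).flatMap fun _ => [0, 0])
  | 0, φ => by simp [Language.BoundedFormula.exs]
  | n + 1, φ => by
    have h : tokens φ.ex = [3, 4, 3] ++ (tokens φ ++ [0, 0]) := by
      simp [tokens]
    have h0 : (List.range (n + 1)).flatMap (fun _ => [0, 0]) =
        [0, 0] ++ (List.range n).flatMap fun _ => [0, 0] := by
      rw [List.range_succ_eq_map, List.flatMap_cons, List.flatMap_map]
    have h1 : (List.range (n + 1)).flatMap (fun _ => [3, 4, 3]) =
        (List.range n).flatMap (fun _ => [3, 4, 3]) ++ [3, 4, 3] := by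
      rw [List.range_succ, List.flatMap_append, List.flatMap_singleton]
    rw [Language.BoundedFormula.exs, tokens_exs φ.ex, h, h0, h1]
    simp only [List.append_assoc]

theorem tokens_linFormula {C : LinSystem} (hC : C.InRange d n) :
    tokens (linFormula d n C) = linFormulaTokens n C := by
  rw [linFormula, tokens_exs, tokens_linBody hC, linFormulaTokens]

section Primrec

variable {α : Type*} [Primcodable α]

@[fun_prop]
theorem primrec_summandTokens {f : α → ℕ × ℕ} (hf : Primrec f) :
    Primrec fun a => summandTokens (f a) := by
  unfold summandTokens
  fun_prop

@[fun_prop]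
theorem primrec_linTermTokens {f : α → LinTerm} (hf : Primrec f) :
    Primrec fun a => linTermTokens (f a) := by
  unfold linTermTokens
  fun_prop

@[fun_prop]
theorem primrec_linIneqTokens {f : α → LinIneq} (hf : Primrec f) :
    Primrec fun a => linIneqTokens (f a) := by
  unfold linIneqTokens
  fun_prop

@[fun_prop]
theorem primrec_conjTokens {f : α → List LinIneq} (hf : Primrec f) :
    Primrec fun a => conjTokens (f a) := by
  unfold conjTokens
  fun_prop

@[fun_prop]
theorem primrec_disjConjTokens {f : α → List (List LinIneq)} (hf : Primrec f) :
    Primrec fun a => disjConjTokens (f a) := by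
  unfold disjConjTokens
  fun_prop

@[fun_prop]
theorem primrec_conjDisjConjTokens {f : α → List (List (List LinIneq))} (hf : Primrec f) :
    Primrec fun a => conjDisjConjTokens (f a) := by
  unfold conjDisjConjTokens
  fun_prop

@[fun_prop]
theorem primrec_linBodyTokens {f : α → LinSystem} (hf : Primrec f) :
    Primrec fun a => linBodyTokens (f a) := by
  unfold linBodyTokens
  fun_prop

@[fun_prop]
theorem primrec_linFormulaTokens {f : α → ℕ} {g : α → LinSystem} (hf : Primrec f)
    (hg : Primrec g) : Primrec fun a => linFormulaTokens (f a) (g a) := by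
  unfold linFormulaTokens
  fun_prop

end Primrec

end Presburger

/-! ### The linear system of a walk problem -/

/-- An edge as finite data: source, target and vector. -/
abbrev EdgeCode : Type := ℕ × ℕ × List ℤ

/-- Finite data `(d, S, E, I, t)` asking for walks in a graph with vertices below `S`, edge list
`E` and final vertex `t`, which start in one of the pairs in `I` of a vertex and a `d × d` matrix
`M`, and transform `u` into `M u` plus the sum of the vectors of their edges. -/
abbrev WalkProblem : Type := ℕ × ℕ × List EdgeCode × List (ℕ × List (List ℤ)) × ℕ

/-- The entry of a matrix given by the list of its rows. -/
def matEntry (M : List (List ℤ)) (i j : ℕ) : ℤ := (M.getD i []).getD j 0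

namespace WalkProblem

/-- The dimension. -/
def dim (x : WalkProblem) : ℕ := x.1

/-- The number of vertices. -/
def numVertices (x : WalkProblem) : ℕ := x.2.1

/-- The list of edges. -/
def edges (x : WalkProblem) : List EdgeCode := x.2.2.1

/-- The list of possible starts. -/
def starts (x : WalkProblem) : List (ℕ × List (List ℤ)) := x.2.2.2.1

/-- The final vertex. -/
def final (x : WalkProblem) : ℕ := x.2.2.2.2

/-- The number of edges. -/
def numEdges (x : WalkProblem) : ℕ := x.edges.length

/-- The source of an edge. -/
def src (x : WalkProblem) (e : ℕ) : ℕ := (x.edges.getD e (0, 0, [])).1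

/-- The target of an edge. -/
def tgt (x : WalkProblem) (e : ℕ) : ℕ := (x.edges.getD e (0, 0, [])).2.1

/-- A coordinate of the vector of an edge. -/
def vec (x : WalkProblem) (e i : ℕ) : ℤ := (x.edges.getD e (0, 0, [])).2.2.getD i 0

/-- All integer coefficients of the problem. -/
def coeffs (x : WalkProblem) : List ℤ :=
  (x.edges.flatMap fun e => e.2.2) ++ x.starts.flatMap fun s => s.2.flatten

/-- A number of bits that suffices for every coefficient. -/
def bits (x : WalkProblem) : ℕ := (x.coeffs.map fun c => c.natAbs.size).sum

/-- The number of quantities that are multiplied by coefficients: the coordinates of the initial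
vector, followed by the multiplicities of the edges. -/
def numBase (x : WalkProblem) : ℕ := x.dim + x.numEdges

/-- The bound variable for `2 ^ k` times the base quantity `b`. -/
def double (x : WalkProblem) (k b : ℕ) : ℕ × ℕ := (2, k * x.numBase + b)

/-- The bound variable for the multiplicity of an edge. -/
def mult (x : WalkProblem) (e : ℕ) : ℕ × ℕ := x.double 0 (x.dim + e)

/-- The bound variable for the rank of a vertex. -/
def rank (x : WalkProblem) (s : ℕ) : ℕ × ℕ := (2, (x.bits + 1) * x.numBase + s)

/-- The number of bound variables. -/
def numBound (x : WalkProblem) : ℕ := (x.bits + 1) * x.numBase + x.numVertices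

/-- The equation `l = r`, as a disjunction with one member. -/
def equation (l r : LinTerm) : List (List LinIneq) := [ [(l, r), (r, l)] ]

/-- The term `1` if `a = b`, and `0` otherwise. -/
def oneIf (a b : ℕ) : LinTerm := if a = b then [(3, 0)] else []

/-- The coefficient `c` times the base quantity `b`, by the binary expansion of `c`. -/
def scaled (x : WalkProblem) (c b : ℕ) : LinTerm :=
  (List.range x.bits).flatMap fun k => if c / 2 ^ k % 2 = 1 then [x.double k b] else []

/-- The inflow at a vertex. -/
def inTerm (x : WalkProblem) (s : ℕ) : LinTerm :=
  (List.range x.numEdges).flatMap fun e => if x.tgt e = s then [x.mult e] else []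

/-- The outflow at a vertex. -/
def outTerm (x : WalkProblem) (s : ℕ) : LinTerm :=
  (List.range x.numEdges).flatMap fun e => if x.src e = s then [x.mult e] else []

/-- The positive part of the coordinate `i` of the final vector. -/
def posTerm (x : WalkProblem) (M : List (List ℤ)) (i : ℕ) : LinTerm :=
  ((List.range x.dim).flatMap fun j => x.scaled (matEntry M i j).toNat j) ++
    (List.range x.numEdges).flatMap fun e => x.scaled (x.vec e i).toNat (x.dim + e)

/-- The negative part of the coordinate `i` of the final vector. -/
def negTerm (x : WalkProblem) (M : List (List ℤ)) (i : ℕ) : LinTerm :=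
  ((List.range x.dim).flatMap fun j => x.scaled (-matEntry M i j).toNat j) ++
    (List.range x.numEdges).flatMap fun e => x.scaled (-x.vec e i).toNat (x.dim + e)

/-- The first base quantities are the coordinates of the initial vector. -/
def linkClauses (x : WalkProblem) : List (List (List LinIneq)) :=
  (List.range x.dim).map fun j => equation [x.double 0 j] [(0, j)]

/-- Each doubling variable is twice the previous one. -/
def doubleClauses (x : WalkProblem) : List (List (List LinIneq)) :=
  (List.range x.bits).flatMap fun k => (List.range x.numBase).map fun b =>
    equation [x.double (k + 1) b] [x.double k b, x.double k b]

/-- Multiplicities are nonnegative. -/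
def nonnegClauses (x : WalkProblem) : List (List (List LinIneq)) :=
  (List.range x.numEdges).map fun e => [ [([], [x.mult e])] ]

/-- Kirchhoff's law for the multiplicities. -/
def flowClauses (x : WalkProblem) (s₀ : ℕ) : List (List (List LinIneq)) :=
  (List.range x.numVertices).map fun s =>
    equation (oneIf s s₀ ++ x.inTerm s) (oneIf s x.final ++ x.outTerm s)

/-- The support of the multiplicities leads down to the final vertex. -/
def descendClauses (x : WalkProblem) : List (List (List LinIneq)) :=
  (List.range x.numEdges).map fun e => [([x.mult e], [])] ::
    ((if x.src e = x.final then [ [] ] else []) ++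
      (List.range x.numEdges).flatMap fun e' => if x.src e' = x.src e then
        [ [([(3, 0)], [x.mult e']), ([(3, 0), x.rank (x.tgt e')], [x.rank (x.src e)])] ] else [])

/-- The final vector is the given one. -/
def effectClauses (x : WalkProblem) (M : List (List ℤ)) : List (List (List LinIneq)) :=
  (List.range x.dim).map fun i => equation ((1, i) :: x.negTerm M i) (x.posTerm M i)

/-- All conditions for a given start. -/
def clauses (x : WalkProblem) (s : ℕ × List (List ℤ)) : List (List (List LinIneq)) :=
  x.linkClauses ++ (x.doubleClauses ++ (x.nonnegClauses ++ (x.flowClauses s.1 ++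
    (x.descendClauses ++ x.effectClauses s.2))))

/-- The system of a walk problem. -/
def system (x : WalkProblem) : LinSystem := x.starts.map x.clauses

section Primrec

variable {α : Type*} [Primcodable α]

@[fun_prop]
theorem primrec_matEntry {f : α → List (List ℤ)} {g : α → ℕ} {h : α → ℕ}
    (hf : Primrec f) (hg : Primrec g) (hh : Primrec h) :
    Primrec fun a => matEntry (f a) (g a) (h a) := by
  unfold matEntry
  fun_prop

@[fun_prop]
theorem primrec_dim {f : α → WalkProblem} (hf : Primrec f) :
    Primrec fun a => dim (f a) := by
  unfold dim
  fun_prop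

@[fun_prop]
theorem primrec_numVertices {f : α → WalkProblem} (hf : Primrec f) :
    Primrec fun a => numVertices (f a) := by
  unfold numVertices
  fun_prop

@[fun_prop]
theorem primrec_edges {f : α → WalkProblem} (hf : Primrec f) :
    Primrec fun a => edges (f a) := by
  unfold edges
  fun_prop

@[fun_prop]
theorem primrec_starts {f : α → WalkProblem} (hf : Primrec f) :
    Primrec fun a => starts (f a) := by
  unfold starts
  fun_prop

@[fun_prop]
theorem primrec_final {f : α → WalkProblem} (hf : Primrec f) :
    Primrec fun a => final (f a) := by
  unfold final
  fun_prop

@[fun_prop]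
theorem primrec_numEdges {f : α → WalkProblem} (hf : Primrec f) :
    Primrec fun a => numEdges (f a) := by
  unfold numEdges
  fun_prop

@[fun_prop]
theorem primrec_src {f : α → WalkProblem} {g : α → ℕ} (hf : Primrec f) (hg : Primrec g) :
    Primrec fun a => src (f a) (g a) := by
  unfold src
  fun_prop

@[fun_prop]
theorem primrec_tgt {f : α → WalkProblem} {g : α → ℕ} (hf : Primrec f) (hg : Primrec g) :
    Primrec fun a => tgt (f a) (g a) := by
  unfold tgt
  fun_prop

@[fun_prop]
theorem primrec_vec {f : α → WalkProblem} {g : α → ℕ} {h : α → ℕ}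
    (hf : Primrec f) (hg : Primrec g) (hh : Primrec h) :
    Primrec fun a => vec (f a) (g a) (h a) := by
  unfold vec
  fun_prop

@[fun_prop]
theorem primrec_coeffs {f : α → WalkProblem} (hf : Primrec f) :
    Primrec fun a => coeffs (f a) := by
  unfold coeffs
  fun_prop

@[fun_prop]
theorem primrec_bits {f : α → WalkProblem} (hf : Primrec f) :
    Primrec fun a => bits (f a) := by
  unfold bits
  fun_prop

@[fun_prop]
theorem primrec_numBase {f : α → WalkProblem} (hf : Primrec f) :
    Primrec fun a => numBase (f a) := by
  unfold numBase
  fun_prop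

@[fun_prop]
theorem primrec_double {f : α → WalkProblem} {g : α → ℕ} {h : α → ℕ}
    (hf : Primrec f) (hg : Primrec g) (hh : Primrec h) :
    Primrec fun a => double (f a) (g a) (h a) := by
  unfold double
  fun_prop

@[fun_prop]
theorem primrec_mult {f : α → WalkProblem} {g : α → ℕ} (hf : Primrec f) (hg : Primrec g) :
    Primrec fun a => mult (f a) (g a) := by
  unfold mult
  fun_prop

@[fun_prop]
theorem primrec_rank {f : α → WalkProblem} {g : α → ℕ} (hf : Primrec f) (hg : Primrec g) :
    Primrec fun a => rank (f a) (g a) := by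
  unfold rank
  fun_prop

@[fun_prop]
theorem primrec_numBound {f : α → WalkProblem} (hf : Primrec f) :
    Primrec fun a => numBound (f a) := by
  unfold numBound
  fun_prop

@[fun_prop]
theorem primrec_equation {f : α → LinTerm} {g : α → LinTerm} (hf : Primrec f) (hg : Primrec g) :
    Primrec fun a => equation (f a) (g a) := by
  unfold equation
  fun_prop

@[fun_prop]
theorem primrec_oneIf {f : α → ℕ} {g : α → ℕ} (hf : Primrec f) (hg : Primrec g) :
    Primrec fun a => oneIf (f a) (g a) := by
  unfold oneIf
  fun_prop

@[fun_prop]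
theorem primrec_scaled {f : α → WalkProblem} {g : α → ℕ} {h : α → ℕ}
    (hf : Primrec f) (hg : Primrec g) (hh : Primrec h) :
    Primrec fun a => scaled (f a) (g a) (h a) := by
  unfold scaled
  fun_prop

@[fun_prop]
theorem primrec_inTerm {f : α → WalkProblem} {g : α → ℕ} (hf : Primrec f) (hg : Primrec g) :
    Primrec fun a => inTerm (f a) (g a) := by
  unfold inTerm
  fun_prop

@[fun_prop]
theorem primrec_outTerm {f : α → WalkProblem} {g : α → ℕ} (hf : Primrec f) (hg : Primrec g) :
    Primrec fun a => outTerm (f a) (g a) := by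
  unfold outTerm
  fun_prop

@[fun_prop]
theorem primrec_posTerm {f : α → WalkProblem} {g : α → List (List ℤ)} {h : α → ℕ}
    (hf : Primrec f) (hg : Primrec g) (hh : Primrec h) :
    Primrec fun a => posTerm (f a) (g a) (h a) := by
  unfold posTerm
  fun_prop

@[fun_prop]
theorem primrec_negTerm {f : α → WalkProblem} {g : α → List (List ℤ)} {h : α → ℕ}
    (hf : Primrec f) (hg : Primrec g) (hh : Primrec h) :
    Primrec fun a => negTerm (f a) (g a) (h a) := by
  unfold negTerm
  fun_prop

@[fun_prop]
theorem primrec_linkClauses {f : α → WalkProblem} (hf : Primrec f) :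
    Primrec fun a => linkClauses (f a) := by
  unfold linkClauses
  fun_prop

@[fun_prop]
theorem primrec_doubleClauses {f : α → WalkProblem} (hf : Primrec f) :
    Primrec fun a => doubleClauses (f a) := by
  unfold doubleClauses
  fun_prop

@[fun_prop]
theorem primrec_nonnegClauses {f : α → WalkProblem} (hf : Primrec f) :
    Primrec fun a => nonnegClauses (f a) := by
  unfold nonnegClauses
  fun_prop

@[fun_prop]
theorem primrec_flowClauses {f : α → WalkProblem} {g : α → ℕ} (hf : Primrec f) (hg : Primrec g) :
    Primrec fun a => flowClauses (f a) (g a) := by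
  unfold flowClauses
  fun_prop

@[fun_prop]
theorem primrec_descendClauses {f : α → WalkProblem} (hf : Primrec f) :
    Primrec fun a => descendClauses (f a) := by
  unfold descendClauses
  fun_prop

@[fun_prop]
theorem primrec_effectClauses {f : α → WalkProblem} {g : α → List (List ℤ)}
    (hf : Primrec f) (hg : Primrec g) :
    Primrec fun a => effectClauses (f a) (g a) := by
  unfold effectClauses
  fun_prop

@[fun_prop]
theorem primrec_clauses {f : α → WalkProblem} {g : α → ℕ × List (List ℤ)}
    (hf : Primrec f) (hg : Primrec g) :
    Primrec fun a => clauses (f a) (g a) := by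
  unfold clauses
  fun_prop

@[fun_prop]
theorem primrec_system {f : α → WalkProblem} (hf : Primrec f) :
    Primrec fun a => system (f a) := by
  unfold system
  fun_prop

end Primrec

/-- All vertices of the problem are below the number of vertices. -/
structure Valid (x : WalkProblem) : Prop where
  src_lt : ∀ e < x.numEdges, x.src e < x.numVertices
  tgt_lt : ∀ e < x.numEdges, x.tgt e < x.numVertices
  start_lt : ∀ s ∈ x.starts, s.1 < x.numVertices
  final_lt : x.final < x.numVertices

end WalkProblem

/-! ### The solutions of the linear system are the walks -/

namespace LinTerm

variable (ρ : ℕ → ℕ → ℤ)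

@[simp]
theorem eval_nil : eval ρ [] = 0 := rfl

@[simp]
theorem eval_cons (a : ℕ × ℕ) (l : LinTerm) : eval ρ (a :: l) = ρ a.1 a.2 + eval ρ l := by
  simp [eval]

@[simp]
theorem eval_append (l l' : LinTerm) : eval ρ (l ++ l') = eval ρ l + eval ρ l' := by
  simp [eval]

@[simp]
theorem eval_flatMap_range (n : ℕ) (f : ℕ → LinTerm) :
    eval ρ ((List.range n).flatMap f) = ∑ i ∈ Finset.range n, eval ρ (f i) := by
  induction n with
  | zero => simp
  | succ n ih =>
    rw [List.range_succ, List.flatMap_append, eval_append, ih, Finset.sum_range_succ,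
      List.flatMap_singleton]

@[simp]
theorem eval_ite (p : Prop) [Decidable p] (l l' : LinTerm) :
    eval ρ (if p then l else l') = if p then eval ρ l else eval ρ l' := by
  split_ifs <;> rfl

end LinTerm

theorem sum_binary_digits (c K : ℕ) (hc : c.size ≤ K) :
    ∑ k ∈ Finset.range K, (if c / 2 ^ k % 2 = 1 then 2 ^ k else 0 : ℤ) = c := by
  have h : ∀ K : ℕ, ∑ k ∈ Finset.range K, (if c / 2 ^ k % 2 = 1 then 2 ^ k else 0 : ℤ) =
      (c % 2 ^ K : ℕ) := by
    intro K
    induction K with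
    | zero => simp [Nat.mod_one]
    | succ K ih =>
      rw [Finset.sum_range_succ, ih, Nat.mod_pow_succ]
      rcases Nat.mod_two_eq_zero_or_one (c / 2 ^ K) with h | h <;> simp [h]
  rw [h, Nat.mod_eq_of_lt (Nat.size_le.1 hc)]

namespace WalkProblem

variable {x : WalkProblem} {u v w : ℕ → ℤ} {ρ : ℕ → ℕ → ℤ}

/-- The disjunction `b` of conjunctions of inequalities holds under `ρ`. -/
def HoldsAt (ρ : ℕ → ℕ → ℤ) (b : List (List LinIneq)) : Prop :=
  ∃ c ∈ b, ∀ i ∈ c, LinTerm.eval ρ i.1 ≤ LinTerm.eval ρ i.2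

theorem holdsAt_equation {l r : LinTerm} :
    HoldsAt ρ (equation l r) ↔ l.eval ρ = r.eval ρ := by
  simp only [HoldsAt, equation, List.mem_singleton, exists_eq_left, List.forall_mem_cons,
    forall_eq, le_antisymm_iff]

theorem eval_oneIf {a b : ℕ} : (oneIf a b).eval (assignment u v w) = if a = b then 1 else 0 := by
  simp [oneIf, assignment]

theorem linkClauses_iff : (∀ b ∈ x.linkClauses, HoldsAt (assignment u v w) b) ↔
    ∀ j < x.dim, w j = u j := by
  simp [linkClauses, holdsAt_equation, double, assignment]

theorem doubleClauses_iff : (∀ b ∈ x.doubleClauses, HoldsAt (assignment u v w) b) ↔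
    ∀ k < x.bits, ∀ b < x.numBase,
      w ((k + 1) * x.numBase + b) = w (k * x.numBase + b) + w (k * x.numBase + b) := by
  simp only [doubleClauses, List.mem_flatMap, List.mem_map, List.mem_range]
  constructor
  · intro h k hk b hb
    simpa [holdsAt_equation, double, assignment] using h _ ⟨k, hk, b, hb, rfl⟩
  · rintro h _ ⟨k, hk, b, hb, rfl⟩
    simpa [holdsAt_equation, double, assignment] using h k hk b hb

theorem nonnegClauses_iff : (∀ b ∈ x.nonnegClauses, HoldsAt (assignment u v w) b) ↔
    ∀ e < x.numEdges, 0 ≤ w (x.dim + e) := by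
  simp [nonnegClauses, HoldsAt, mult, double, assignment]

theorem flowClauses_iff {s₀ : ℕ} :
    (∀ b ∈ x.flowClauses s₀, HoldsAt (assignment u v w) b) ↔ ∀ s < x.numVertices,
      (if s = s₀ then 1 else 0) +
        ∑ e ∈ Finset.range x.numEdges, (if x.tgt e = s then w (x.dim + e) else 0) =
      (if s = x.final then 1 else 0) +
        ∑ e ∈ Finset.range x.numEdges, (if x.src e = s then w (x.dim + e) else 0) := by
  simp [flowClauses, holdsAt_equation, eval_oneIf, inTerm, outTerm, mult, double, assignment]

theorem descendClauses_iff :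
    (∀ b ∈ x.descendClauses, HoldsAt (assignment u v w) b) ↔ ∀ e < x.numEdges,
      w (x.dim + e) ≤ 0 ∨ x.src e = x.final ∨ ∃ e' < x.numEdges, x.src e' = x.src e ∧
        1 ≤ w (x.dim + e') ∧ 1 + w ((x.bits + 1) * x.numBase + x.tgt e') ≤
          w ((x.bits + 1) * x.numBase + x.src e) := by
  simp only [descendClauses, List.mem_map, List.mem_range, forall_exists_index, and_imp,
    forall_apply_eq_imp_iff₂]
  refine forall₂_congr fun e _ => ?_
  rw [HoldsAt, List.exists_mem_cons_iff]
  refine or_congr (by simp [mult, double, assignment]) ?_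
  simp only [List.mem_append, or_and_right, exists_or]
  refine or_congr ?_ ?_
  · by_cases h : x.src e = x.final <;> simp [h]
  · simp only [List.mem_flatMap, List.mem_range]
    constructor
    · rintro ⟨c, ⟨e', he', hc⟩, hi⟩
      split_ifs at hc with h
      · obtain rfl := List.mem_singleton.1 hc
        simp [mult, double, rank, assignment] at hi
        exact ⟨e', he', h, hi.1, hi.2⟩
      · simp at hc
    · rintro ⟨e', he', h, h1, h2⟩
      refine ⟨_, ⟨e', he', by rw [if_pos h]; exact List.mem_singleton_self _⟩, ?_⟩
      simpa [mult, double, rank, assignment] using ⟨h1, h2⟩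

theorem double_eq (h : ∀ k < x.bits, ∀ b < x.numBase,
      w ((k + 1) * x.numBase + b) = w (k * x.numBase + b) + w (k * x.numBase + b))
    {b : ℕ} (hb : b < x.numBase) {k : ℕ} (hk : k ≤ x.bits) :
    w (k * x.numBase + b) = 2 ^ k * w b := by
  induction k with
  | zero => simp
  | succ k ih =>
    rw [h k hk b hb, ih (Nat.le_of_succ_le hk)]
    ring

theorem eval_scaled (h : ∀ k < x.bits, ∀ b < x.numBase,
      w ((k + 1) * x.numBase + b) = w (k * x.numBase + b) + w (k * x.numBase + b))
    {b : ℕ} (hb : b < x.numBase) {c : ℕ} (hc : c.size ≤ x.bits) :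
    (x.scaled c b).eval (assignment u v w) = c * w b := by
  rw [← sum_binary_digits c _ hc, scaled, LinTerm.eval_flatMap_range, Finset.sum_mul]
  refine Finset.sum_congr rfl fun k hk => ?_
  rw [LinTerm.eval_ite]
  split_ifs
  · simp [double, assignment, double_eq h hb (Finset.mem_range.1 hk).le]
  · simp

theorem size_le_bits {c : ℤ} (hc : c ∈ x.coeffs) : c.natAbs.size ≤ x.bits :=
  List.le_sum_of_mem (List.mem_map_of_mem hc)

theorem getD_eq_or_mem {α : Type*} (l : List α) (i : ℕ) (a : α) :
    l.getD i a = a ∨ l.getD i a ∈ l := by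
  rw [List.getD_eq_getElem?_getD]
  by_cases h : i < l.length
  · simp [h]
  · simp [not_lt.1 h]

theorem size_matEntry_le {s : ℕ × List (List ℤ)} (hs : s ∈ x.starts) (i j : ℕ) :
    (matEntry s.2 i j).natAbs.size ≤ x.bits := by
  rcases getD_eq_or_mem (s.2.getD i []) j 0 with h | h
  · rw [matEntry, h]; simp
  · refine size_le_bits (List.mem_append_right _ (List.mem_flatMap.2 ⟨s, hs, ?_⟩))
    rcases getD_eq_or_mem s.2 i [] with h' | h'
    · rw [h'] at h
      cases h
    · exact List.mem_flatten.2 ⟨_, h', h⟩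

theorem size_vec_le (x : WalkProblem) (e i : ℕ) : (x.vec e i).natAbs.size ≤ x.bits := by
  rcases getD_eq_or_mem (x.edges.getD e (0, 0, [])).2.2 i 0 with h | h
  · rw [vec, h]; simp
  · refine size_le_bits (List.mem_append_left _ (List.mem_flatMap.2 ⟨_, ?_, h⟩))
    rcases getD_eq_or_mem x.edges e (0, 0, []) with h' | h'
    · rw [h'] at h
      cases h
    · exact h'

theorem effectClauses_iff (h : ∀ k < x.bits, ∀ b < x.numBase,
      w ((k + 1) * x.numBase + b) = w (k * x.numBase + b) + w (k * x.numBase + b))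
    {s : ℕ × List (List ℤ)} (hs : s ∈ x.starts) :
    (∀ b ∈ x.effectClauses s.2, HoldsAt (assignment u v w) b) ↔ ∀ i < x.dim,
      v i = ∑ j ∈ Finset.range x.dim, matEntry s.2 i j * w j +
        ∑ e ∈ Finset.range x.numEdges, x.vec e i * w (x.dim + e) := by
  have hterm : ∀ (c : ℤ) (b : ℕ), c.natAbs.size ≤ x.bits → b < x.numBase →
      (x.scaled c.toNat b).eval (assignment u v w) =
        (x.scaled (-c).toNat b).eval (assignment u v w) + c * w b := by
    intro c b hc hb
    rw [eval_scaled h hb ((Nat.size_le_size (by omega)).trans hc),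
      eval_scaled h hb ((Nat.size_le_size (by omega)).trans hc), ← add_mul]
    congr 1
    omega
  have hpos : ∀ i, (x.posTerm s.2 i).eval (assignment u v w) =
      (x.negTerm s.2 i).eval (assignment u v w) +
        (∑ j ∈ Finset.range x.dim, matEntry s.2 i j * w j +
          ∑ e ∈ Finset.range x.numEdges, x.vec e i * w (x.dim + e)) := by
    intro i
    simp only [posTerm, negTerm, LinTerm.eval_append, LinTerm.eval_flatMap_range]
    rw [Finset.sum_congr rfl fun j hj => hterm _ j (size_matEntry_le hs i j)
        (Nat.lt_add_right _ (Finset.mem_range.1 hj)),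
      Finset.sum_congr rfl fun e he => hterm _ (x.dim + e) (x.size_vec_le e i)
        (Nat.add_lt_add_left (Finset.mem_range.1 he) _),
      Finset.sum_add_distrib, Finset.sum_add_distrib]
    ring
  simp only [effectClauses, List.mem_map, List.mem_range, forall_exists_index, and_imp,
    forall_apply_eq_imp_iff₂, holdsAt_equation, LinTerm.eval_cons, hpos]
  refine forall₂_congr fun i _ => ?_
  rw [show assignment u v w (1, i).1 (1, i).2 = v i from rfl, add_comm (v i)]
  exact add_right_inj _

/-- The source map on the edges of the problem. -/
def srcFin (x : WalkProblem) (e : Fin x.numEdges) : ℕ := x.src e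

/-- The target map on the edges of the problem. -/
def tgtFin (x : WalkProblem) (e : Fin x.numEdges) : ℕ := x.tgt e

/-- `(u, v)` is a solution of the problem: some walk from a start to the final vertex transforms
`u` into `v`. -/
def IsSolution (x : WalkProblem) (u v : ℕ → ℤ) : Prop :=
  ∃ s ∈ x.starts, ∃ l : List (Fin x.numEdges), IsWalk x.srcFin x.tgtFin s.1 l x.final ∧
    ∀ i < x.dim, v i = ∑ j ∈ Finset.range x.dim, matEntry s.2 i j * u j +
      (l.map fun e : Fin x.numEdges => x.vec e i).sum

theorem sat_system_iff : x.system.Sat (assignment u v w) ↔ ∃ s ∈ x.starts,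
    (∀ b ∈ x.linkClauses, HoldsAt (assignment u v w) b) ∧
    (∀ b ∈ x.doubleClauses, HoldsAt (assignment u v w) b) ∧
    (∀ b ∈ x.nonnegClauses, HoldsAt (assignment u v w) b) ∧
    (∀ b ∈ x.flowClauses s.1, HoldsAt (assignment u v w) b) ∧
    (∀ b ∈ x.descendClauses, HoldsAt (assignment u v w) b) ∧
    (∀ b ∈ x.effectClauses s.2, HoldsAt (assignment u v w) b) := by
  simp only [LinSystem.Sat, system, List.mem_map, exists_exists_and_eq_and]
  refine exists_congr fun s => and_congr_right fun _ => ?_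
  simp only [clauses, List.forall_mem_append]
  rfl

theorem cast_flowAt {f : Fin x.numEdges → ℕ} {g : ℕ → ℤ} (hfg : ∀ e, (f e : ℤ) = g e)
    (end_ : ℕ → ℕ) (s : ℕ) : (flowAt (fun e : Fin x.numEdges => end_ e) f s : ℤ) =
      ∑ e ∈ Finset.range x.numEdges, if end_ e = s then g e else 0 := by
  rw [Finset.sum_range, flowAt]
  push_cast
  exact Finset.sum_congr rfl fun e _ => by rw [hfg]

theorem sum_vec_eq {f : Fin x.numEdges → ℕ} {g : ℕ → ℤ} (hfg : ∀ e, (f e : ℤ) = g e)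
    {l : List (Fin x.numEdges)} (hl : ∀ e, l.count e = f e) (i : ℕ) :
    (l.map fun e : Fin x.numEdges => x.vec e i).sum =
      ∑ e ∈ Finset.range x.numEdges, x.vec e i * g e := by
  rw [List.sum_map_eq_sum_count, Finset.sum_range]
  exact Finset.sum_congr rfl fun e _ => by rw [hl, nsmul_eq_mul, hfg, mul_comm]

theorem Valid.isUnitFlow_iff (hx : x.Valid) {s₀ : ℕ} (hs₀ : s₀ < x.numVertices)
    {f : Fin x.numEdges → ℕ} {g : ℕ → ℤ} (hfg : ∀ e, (f e : ℤ) = g e) :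
    IsUnitFlow x.srcFin x.tgtFin f s₀ x.final ↔ ∀ s < x.numVertices,
      (if s = s₀ then 1 else 0) + ∑ e ∈ Finset.range x.numEdges, (if x.tgt e = s then g e else 0) =
      (if s = x.final then 1 else 0) +
        ∑ e ∈ Finset.range x.numEdges, (if x.src e = s then g e else 0) := by
  simp only [← cast_flowAt hfg]
  constructor
  · intro h s _
    have : flowAt (fun e : Fin x.numEdges => x.tgt e) f s + _ =
      flowAt (fun e : Fin x.numEdges => x.src e) f s + _ := h s
    split_ifs at * <;> omega
  · intro h s
    by_cases hs : s < x.numVertices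
    · have := h s hs
      change flowAt (fun e : Fin x.numEdges => x.tgt e) f s + _ =
        flowAt (fun e : Fin x.numEdges => x.src e) f s + _
      split_ifs at * <;> omega
    · -- no edge touches a vertex out of range
      have h0 : flowAt x.tgtFin f s = 0 := Nat.eq_zero_of_not_pos fun h => by
        obtain ⟨e, rfl, -⟩ := flowAt_pos_iff.1 h
        exact hs (hx.tgt_lt e e.2)
      have h1 : flowAt x.srcFin f s = 0 := Nat.eq_zero_of_not_pos fun h => by
        obtain ⟨e, rfl, -⟩ := flowAt_pos_iff.1 h
        exact hs (hx.src_lt e e.2)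
      rw [h0, h1, if_neg (by omega), if_neg (by have := hx.final_lt; omega)]

theorem Valid.isSolution_of_sat (hx : x.Valid) (h : x.system.Sat (assignment u v w)) :
    x.IsSolution u v := by
  obtain ⟨s, hs, hlink, hdouble, hnonneg, hflow, hdesc, heff⟩ := sat_system_iff.1 h
  rw [linkClauses_iff] at hlink
  rw [doubleClauses_iff] at hdouble
  rw [nonnegClauses_iff] at hnonneg
  rw [flowClauses_iff] at hflow
  rw [descendClauses_iff] at hdesc
  rw [effectClauses_iff hdouble hs] at heff
  let f (e : Fin x.numEdges) : ℕ := (w (x.dim + e)).toNat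
  have hf : ∀ e, (f e : ℤ) = w (x.dim + e) := fun e => Int.toNat_of_nonneg (hnonneg e e.2)
  have hunit : IsUnitFlow x.srcFin x.tgtFin f s.1 x.final :=
    (hx.isUnitFlow_iff (hx.start_lt s hs) (g := fun e => w (x.dim + e)) hf).2 hflow
  have hz : Descends x.srcFin x.tgtFin f x.final
      fun s => w ((x.bits + 1) * x.numBase + s) := by
    intro e
    rcases hdesc e e.2 with h | h | ⟨e', he', h1, h2, h3⟩
    · exact .inl (by have := hf e; omega)
    · exact .inr (.inl h)
    · refine .inr (.inr ⟨⟨e', he'⟩, h1, ?_, ?_⟩)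
      · have := hf ⟨e', he'⟩
        dsimp only at this
        omega
      · simp only [srcFin, tgtFin]
        omega
  obtain ⟨l, hl, hcount⟩ := exists_walk_count_iff.2 ⟨hunit, _, hz⟩
  refine ⟨s, hs, l, hl, fun i hi => ?_⟩
  rw [heff i hi, sum_vec_eq (g := fun e => w (x.dim + e)) hf hcount]
  refine congrArg (· + _) (Finset.sum_congr rfl fun j hj => ?_)
  rw [hlink j (Finset.mem_range.1 hj)]

theorem Valid.sat_of_isSolution (hx : x.Valid) (h : x.IsSolution u v) :
    ∃ w, x.system.Sat (assignment u v w) := by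
  obtain ⟨s, hs, l, hl, hv⟩ := h
  obtain ⟨hunit, z, hz⟩ := exists_walk_count_iff.1 ⟨l, hl, fun _ => rfl⟩
  -- the bound variables are `bits + 1` blocks, the block `k` holding `2 ^ k` times the base
  -- quantities, followed by the ranks
  let base (b : ℕ) : ℤ := if b < x.dim then u b else
    if h : b - x.dim < x.numEdges then l.count ⟨b - x.dim, h⟩ else 0
  let w (a : ℕ) : ℤ := if a < (x.bits + 1) * x.numBase then
    2 ^ (a / x.numBase) * base (a % x.numBase) else z (a - (x.bits + 1) * x.numBase)
  have hw : ∀ k ≤ x.bits, ∀ b < x.numBase, w (k * x.numBase + b) = 2 ^ k * base b := by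
    intro k hk b hb
    have h1 : k * x.numBase + b < (x.bits + 1) * x.numBase :=
      calc k * x.numBase + b < k * x.numBase + x.numBase := Nat.add_lt_add_left hb _
        _ = (k + 1) * x.numBase := (Nat.succ_mul _ _).symm
        _ ≤ _ := Nat.mul_le_mul_right _ (Nat.succ_le_succ hk)
    have h2 : (k * x.numBase + b) / x.numBase = k := by
      rw [mul_comm, Nat.mul_add_div (by omega), Nat.div_eq_of_lt hb, add_zero]
    have h3 : (k * x.numBase + b) % x.numBase = b := by
      rw [mul_comm, Nat.mul_add_mod, Nat.mod_eq_of_lt hb]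
    simp only [w, if_pos h1, h2, h3]
  have hw0 : ∀ b < x.numBase, w b = base b := fun b hb => by simpa using hw 0 (Nat.zero_le _) b hb
  have hwu : ∀ j < x.dim, w j = u j := fun j hj => by
    rw [hw0 j (Nat.lt_add_right _ hj)]
    simp only [base, if_pos hj]
  have hwf : ∀ e : Fin x.numEdges, (l.count e : ℤ) = w (x.dim + e) := fun e => by
    rw [hw0 _ (Nat.add_lt_add_left e.2 _)]
    simp [base]
  have hwz : ∀ s, w ((x.bits + 1) * x.numBase + s) = z s := fun s => by simp [w]
  have hdouble : ∀ k < x.bits, ∀ b < x.numBase,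
      w ((k + 1) * x.numBase + b) = w (k * x.numBase + b) + w (k * x.numBase + b) := by
    intro k hk b hb
    rw [hw (k + 1) hk b hb, hw k hk.le b hb]
    ring
  refine ⟨w, sat_system_iff.2 ⟨s, hs, linkClauses_iff.2 hwu, doubleClauses_iff.2 hdouble,
    nonnegClauses_iff.2 fun e he => ?_, flowClauses_iff.2 ?_, descendClauses_iff.2 fun e he => ?_,
    (effectClauses_iff hdouble hs).2 fun i hi => ?_⟩⟩
  · have := hwf ⟨e, he⟩
    dsimp only at this
    omega
  · exact (hx.isUnitFlow_iff (hx.start_lt s hs) (g := fun e => w (x.dim + e)) hwf).1 hunit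
  · have he0 := hwf ⟨e, he⟩
    dsimp only at he0
    rcases hz ⟨e, he⟩ with h | h | ⟨e', h1, h2, h3⟩
    · dsimp only at h
      exact .inl (by omega)
    · exact .inr (.inl h)
    · dsimp only at h2
      have := hwf e'
      refine .inr (.inr ⟨e', e'.2, h1, by omega, ?_⟩)
      rw [hwz, hwz]
      exact (add_comm _ _).trans_le h3
  · rw [hv i hi, sum_vec_eq (g := fun e => w (x.dim + e)) hwf (fun _ => rfl)]
    refine congrArg (· + _) (Finset.sum_congr rfl fun j hj => ?_)
    rw [hwu j (Finset.mem_range.1 hj)]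

theorem Valid.exists_sat_iff (hx : x.Valid) :
    (∃ w, x.system.Sat (assignment u v w)) ↔ x.IsSolution u v :=
  ⟨fun ⟨_, h⟩ => hx.isSolution_of_sat h, hx.sat_of_isSolution⟩

end WalkProblem

/-! ### The size of the formula of a walk problem -/

namespace WalkProblem

variable {x : WalkProblem}

/-- The indices of the linear term are in range, and it has few summands. -/
structure TermFits (x : WalkProblem) (l : LinTerm) : Prop where
  inRange : l.InRange x.dim x.numBound
  length_le : l.length ≤ 2 + x.bits * x.numBase + x.numEdges

/-- The terms of the clause fit, and its disjuncts are few and short. -/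
structure ClauseFits (x : WalkProblem) (b : List (List LinIneq)) : Prop where
  length_le : b.length ≤ x.numEdges + 2
  length_le_two : ∀ c ∈ b, c.length ≤ 2
  term : ∀ c ∈ b, ∀ i ∈ c, x.TermFits i.1 ∧ x.TermFits i.2

/-- The index of a summand is in range. -/
def SummandInRange (x : WalkProblem) (y : ℕ × ℕ) : Prop :=
  (y.1 < 2 → y.2 < x.dim) ∧ (y.1 = 2 → y.2 < x.numBound)

theorem inRange_double {k b : ℕ} (hk : k ≤ x.bits) (hb : b < x.numBase) :
    x.SummandInRange (x.double k b) := by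
  refine ⟨fun h => absurd h (by simp [double]), fun _ => ?_⟩
  calc k * x.numBase + b < k * x.numBase + x.numBase := Nat.add_lt_add_left hb _
    _ = (k + 1) * x.numBase := (Nat.succ_mul _ _).symm
    _ ≤ (x.bits + 1) * x.numBase := Nat.mul_le_mul_right _ (Nat.succ_le_succ hk)
    _ ≤ _ := Nat.le_add_right _ _

theorem inRange_mult {e : ℕ} (he : e < x.numEdges) : x.SummandInRange (x.mult e) :=
  inRange_double (Nat.zero_le _) (Nat.add_lt_add_left he _)

theorem inRange_rank {s : ℕ} (hs : s < x.numVertices) : x.SummandInRange (x.rank s) :=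
  ⟨fun h => absurd h (by simp [rank]), fun _ => Nat.add_lt_add_left hs _⟩

theorem inRange_one : x.SummandInRange (3, 0) := ⟨fun h => absurd h (by simp), by simp⟩

theorem inRange_free {k i : ℕ} (hk : k < 2) (hi : i < x.dim) : x.SummandInRange (k, i) :=
  ⟨fun _ => hi, fun h => absurd h (by dsimp only; omega)⟩

theorem termFits_short {l : LinTerm} (h : ∀ y ∈ l, x.SummandInRange y) (hl : l.length ≤ 2) :
    x.TermFits l := ⟨h, hl.trans (by omega)⟩

theorem length_flatMap_le {α β : Type*} {l : List α} {f : α → List β} {m : ℕ}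
    (h : ∀ a ∈ l, (f a).length ≤ m) : (l.flatMap f).length ≤ l.length * m := by
  induction l with
  | nil => simp
  | cons a l ih =>
    rw [List.flatMap_cons, List.length_append, List.length_cons, Nat.succ_mul, add_comm]
    exact Nat.add_le_add (ih fun b hb => h b (by simp [hb])) (h a (by simp))

theorem clauseFits_equation {l r : LinTerm} (hl : x.TermFits l) (hr : x.TermFits r) :
    x.ClauseFits (equation l r) := by
  refine ⟨by simp [equation], fun c hc => ?_, fun c hc i hi => ?_⟩
  · obtain rfl := List.mem_singleton.1 hc
    simp
  · obtain rfl := List.mem_singleton.1 hc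
    simp only [List.mem_cons, List.not_mem_nil, or_false] at hi
    rcases hi with rfl | rfl
    · exact ⟨hl, hr⟩
    · exact ⟨hr, hl⟩

theorem scaled_fits {c b : ℕ} (hb : b < x.numBase) :
    (∀ y ∈ x.scaled c b, x.SummandInRange y) ∧ (x.scaled c b).length ≤ x.bits := by
  constructor
  · intro y hy
    obtain ⟨k, hk, hy⟩ := List.mem_flatMap.1 hy
    split_ifs at hy
    · obtain rfl := List.mem_singleton.1 hy
      exact inRange_double (List.mem_range.1 hk).le hb
    · simp at hy
  · refine (length_flatMap_le (m := 1) fun k _ => ?_).trans (by simp)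
    split_ifs <;> simp

/-- The two sides of the effect equations are built from scaled base quantities, one for each
base quantity. -/
theorem scaled_sum_fits (c c' : ℕ → ℕ) :
    (∀ y ∈ ((List.range x.dim).flatMap fun j => x.scaled (c j) j) ++
      (List.range x.numEdges).flatMap fun e => x.scaled (c' e) (x.dim + e), x.SummandInRange y) ∧
    (((List.range x.dim).flatMap fun j => x.scaled (c j) j) ++
      (List.range x.numEdges).flatMap fun e => x.scaled (c' e) (x.dim + e)).length ≤
      x.bits * x.numBase := by
  have h1 : ∀ j ∈ List.range x.dim, j < x.numBase := fun j hj =>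
    Nat.lt_add_right _ (List.mem_range.1 hj)
  have h2 : ∀ e ∈ List.range x.numEdges, x.dim + e < x.numBase := fun e he =>
    Nat.add_lt_add_left (List.mem_range.1 he) _
  constructor
  · intro y hy
    rcases List.mem_append.1 hy with hy | hy
    · obtain ⟨j, hj, hy⟩ := List.mem_flatMap.1 hy
      exact (scaled_fits (h1 j hj)).1 y hy
    · obtain ⟨e, he, hy⟩ := List.mem_flatMap.1 hy
      exact (scaled_fits (h2 e he)).1 y hy
  · rw [List.length_append, numBase, Nat.mul_add]
    refine Nat.add_le_add ?_ ?_
    · refine (length_flatMap_le fun j hj => (scaled_fits (h1 j hj)).2).trans ?_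
      rw [List.length_range, mul_comm]
    · refine (length_flatMap_le fun j hj => (scaled_fits (h2 j hj)).2).trans ?_
      rw [List.length_range, mul_comm]

theorem flow_fits (end_ : ℕ → ℕ) (s a : ℕ) : x.TermFits (oneIf s a ++
    (List.range x.numEdges).flatMap fun e => if end_ e = s then [x.mult e] else []) := by
  constructor
  · intro y hy
    rcases List.mem_append.1 hy with hy | hy
    · rw [oneIf] at hy
      split_ifs at hy
      · obtain rfl := List.mem_singleton.1 hy
        exact inRange_one
      · simp at hy
    · obtain ⟨e, he, hy⟩ := List.mem_flatMap.1 hy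
      split_ifs at hy
      · obtain rfl := List.mem_singleton.1 hy
        exact inRange_mult (List.mem_range.1 he)
      · simp at hy
  · have h1 : (oneIf s a).length ≤ 1 := by rw [oneIf]; split_ifs <;> simp
    have h2 := length_flatMap_le (l := List.range x.numEdges) (m := 1)
      (f := fun e => if end_ e = s then [x.mult e] else []) (fun e _ => by split_ifs <;> simp)
    rw [List.length_range] at h2
    rw [List.length_append]
    omega

theorem Valid.clauseFits (hx : x.Valid) {s : ℕ × List (List ℤ)} :
    ∀ b ∈ x.clauses s, x.ClauseFits b := by
  simp only [clauses, List.forall_mem_append]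
  refine ⟨?_, ?_, ?_, ?_, ?_, ?_⟩
  · simp only [linkClauses, List.forall_mem_map, List.mem_range]
    intro j hj
    have := inRange_double (Nat.zero_le x.bits) (Nat.lt_add_right x.numEdges hj)
    refine clauseFits_equation (termFits_short ?_ (by simp)) (termFits_short ?_ (by simp))
    · simpa using this
    · simpa using inRange_free (k := 0) (by simp) hj
  · simp only [doubleClauses, List.mem_flatMap, List.mem_map, List.mem_range]
    rintro _ ⟨k, hk, b, hb, rfl⟩
    refine clauseFits_equation (termFits_short ?_ (by simp)) (termFits_short ?_ (by simp))
    · simpa using inRange_double hk hb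
    · simpa using inRange_double hk.le hb
  · simp only [nonnegClauses, List.forall_mem_map, List.mem_range]
    intro e he
    refine ⟨by simp, by simp, ?_⟩
    simp only [List.mem_singleton, forall_eq]
    exact ⟨termFits_short (by simp) (by simp),
      termFits_short (by simpa using inRange_mult he) (by simp)⟩
  · simp only [flowClauses, List.forall_mem_map, List.mem_range]
    exact fun v _ => clauseFits_equation (flow_fits ..) (flow_fits ..)
  · simp only [descendClauses, List.forall_mem_map, List.mem_range]
    intro e he
    refine ⟨?_, ?_, ?_⟩
    · have h1 : (if x.src e = x.final then [ [] ] else [] : List (List LinIneq)).length ≤ 1 := by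
        split_ifs <;> simp
      have h2 := length_flatMap_le (l := List.range x.numEdges) (m := 1)
        (f := fun e' => if x.src e' = x.src e then
          [ [([(3, 0)], [x.mult e']), ([(3, 0), x.rank (x.tgt e')], [x.rank (x.src e)])] ] else [])
        (fun e _ => by split_ifs <;> simp)
      rw [List.length_range] at h2
      rw [List.length_cons, List.length_append]
      omega
    all_goals
      intro c hc
      rcases List.mem_cons.1 hc with rfl | hc
    · simp
    · rcases List.mem_append.1 hc with hc | hc
      · split_ifs at hc
        · obtain rfl := List.mem_singleton.1 hc
          simp
        · simp at hc
      · obtain ⟨e', he', hc⟩ := List.mem_flatMap.1 hc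
        split_ifs at hc
        · obtain rfl := List.mem_singleton.1 hc
          simp
        · simp at hc
    · simp only [List.mem_singleton, forall_eq]
      exact ⟨termFits_short (by simpa using inRange_mult he) (by simp),
        termFits_short (by simp) (by simp)⟩
    · rcases List.mem_append.1 hc with hc | hc
      · split_ifs at hc
        · obtain rfl := List.mem_singleton.1 hc
          simp
        · simp at hc
      · obtain ⟨e', he', hc⟩ := List.mem_flatMap.1 hc
        split_ifs at hc
        · obtain rfl := List.mem_singleton.1 hc
          have he' := List.mem_range.1 he'
          simp only [List.forall_mem_cons, List.not_mem_nil, false_imp_iff, implies_true, and_true]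
          refine ⟨⟨termFits_short ?_ (by simp), termFits_short ?_ (by simp)⟩,
            termFits_short ?_ (by simp), termFits_short ?_ (by simp)⟩
          · simpa using inRange_one
          · simpa using inRange_mult he'
          · simpa using ⟨inRange_one, inRange_rank (hx.tgt_lt e' he')⟩
          · simpa using inRange_rank (hx.src_lt e he)
        · simp at hc
  · simp only [effectClauses, List.forall_mem_map, List.mem_range]
    intro i hi
    obtain ⟨h1, h2⟩ := x.scaled_sum_fits (fun j => (-matEntry s.2 i j).toNat)
      (fun e => (-x.vec e i).toNat)
    obtain ⟨h3, h4⟩ := x.scaled_sum_fits (fun j => (matEntry s.2 i j).toNat)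
      (fun e => (x.vec e i).toNat)
    refine clauseFits_equation ⟨fun y hy => ?_, ?_⟩ ⟨h3, h4.trans (by omega)⟩
    · rcases List.mem_cons.1 hy with rfl | hy
      · exact inRange_free (by simp) hi
      · exact h1 y hy
    · rw [List.length_cons]
      exact (Nat.succ_le_succ h2).trans (by omega)

theorem length_clauses (x : WalkProblem) (s : ℕ × List (List ℤ)) : (x.clauses s).length =
    x.dim + (x.bits * x.numBase + (x.numEdges + (x.numVertices + (x.numEdges + x.dim)))) := by
  have : x.doubleClauses.length = x.bits * x.numBase := by
    simp [doubleClauses, List.length_flatMap]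
  simp [clauses, linkClauses, this, nonnegClauses, flowClauses, descendClauses, effectClauses]

theorem Valid.inRange_system (hx : x.Valid) : x.system.InRange x.dim x.numBound := by
  intro a ha b hb c hc i hi
  obtain ⟨s, -, rfl⟩ := List.mem_map.1 ha
  exact ((hx.clauseFits b hb).term c hc i hi).imp TermFits.inRange TermFits.inRange

end WalkProblem

/-! The number of bits of a sequence of tokens is additive, which gives the bounds level by
level. -/

namespace Presburger

/-- The number of bits of a sequence of tokens. -/
def cost (l : List ℕ) : ℕ := (l.map fun k => Nat.size k + 1).sum

theorem cost_nil : cost [] = 0 := rfl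

theorem cost_cons (k : ℕ) (l : List ℕ) : cost (k :: l) = Nat.size k + 1 + cost l := by
  simp [cost]

theorem cost_append (l l' : List ℕ) : cost (l ++ l') = cost l + cost l' := by
  simp [cost]

theorem cost_flatMap_le {α : Type*} {l : List α} {f : α → List ℕ} {m : ℕ}
    (h : ∀ a ∈ l, cost (f a) ≤ m) : cost (l.flatMap f) ≤ l.length * m := by
  induction l with
  | nil => simp [cost]
  | cons a l ih =>
    rw [List.flatMap_cons, cost_append, List.length_cons, Nat.succ_mul, add_comm]
    exact Nat.add_le_add (ih fun b hb => h b (by simp [hb])) (h a (by simp))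

theorem size_le_self (k : ℕ) : k.size ≤ k := Nat.size_le.2 Nat.lt_two_pow_self

theorem size_le_four {k : ℕ} (hk : k ≤ 10) : k.size ≤ 4 :=
  Nat.size_le.2 (hk.trans_lt (by norm_num))

theorem cost_small_cons {k : ℕ} (hk : k ≤ 10) (l : List ℕ) : cost (k :: l) ≤ 5 + cost l := by
  have := size_le_four hk
  rw [cost_cons]
  omega

theorem cost_linTermTokens_le {d n A : ℕ} {l : LinTerm} (hl : l.InRange d n)
    (hA : l.length ≤ A) : cost (linTermTokens l) ≤ A * (d + n + 11) + 5 := by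
  have hs : ∀ y ∈ l, cost (7 :: summandTokens y) ≤ d + n + 11 := by
    intro y hy
    obtain ⟨h1, h2⟩ := hl y hy
    refine (cost_small_cons (by norm_num) _).trans ?_
    have hi := size_le_self y.2
    rw [summandTokens]
    split_ifs with h h' h'
    · refine (Nat.add_le_add_left (cost_small_cons (by norm_num) _) _).trans ?_
      have := h1 (by omega)
      rw [cost_cons, cost_nil]
      omega
    · refine (Nat.add_le_add_left (cost_small_cons (by norm_num) _) _).trans ?_
      have := h1 (by omega)
      rw [cost_cons, cost_nil]
      omega
    · refine (Nat.add_le_add_left (cost_small_cons (by norm_num) _) _).trans ?_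
      have := h2 h'
      rw [cost_cons, cost_nil]
      omega
    · refine (Nat.add_le_add_left (cost_small_cons (by norm_num) _) _).trans ?_
      rw [cost_nil]
      omega
  rw [linTermTokens, cost_append]
  exact Nat.add_le_add ((cost_flatMap_le hs).trans (Nat.mul_le_mul_right _ hA))
    (cost_small_cons (by norm_num) _)

theorem cost_linIneqTokens_le {i : LinIneq} {m : ℕ} (h1 : cost (linTermTokens i.1) ≤ m)
    (h2 : cost (linTermTokens i.2) ≤ m) : cost (linIneqTokens i) ≤ 2 * m + 5 := by
  refine (cost_small_cons (by norm_num) _).trans ?_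
  rw [cost_append]
  omega

theorem cost_conj_le {α : Type*} {l : List α} {f : α → List ℕ} {m : ℕ}
    (h : ∀ a ∈ l, cost (f a) ≤ m) :
    cost (3 :: ((l.flatMap fun a => 3 :: f a) ++ [0, 0])) ≤ l.length * (m + 5) + 15 := by
  refine (cost_small_cons (by norm_num) _).trans ?_
  have h1 : cost [0, 0] ≤ 10 := by simp [cost]
  have h2 := cost_flatMap_le (f := fun a => 3 :: f a) (m := m + 5) fun a ha =>
    (cost_small_cons (by norm_num) _).trans (by have := h a ha; omega)
  rw [cost_append]
  omega

theorem cost_disj_le {α : Type*} {l : List α} {f : α → List ℕ} {m : ℕ}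
    (h : ∀ a ∈ l, cost (f a) ≤ m) :
    cost ((l.flatMap fun a => 3 :: 3 :: (f a ++ [0])) ++ [0]) ≤ l.length * (m + 15) + 5 := by
  have h1 : cost [0] ≤ 5 := by simp [cost]
  have h2 := cost_flatMap_le (f := fun a => 3 :: 3 :: (f a ++ [0])) (m := m + 15) fun a ha => by
    refine (cost_small_cons (by norm_num) _).trans ?_
    refine (Nat.add_le_add_left (cost_small_cons (by norm_num) _) _).trans ?_
    have := h a ha
    rw [cost_append]
    omega
  rw [cost_append]
  omega

end Presburger

namespace WalkProblem

variable {x : WalkProblem}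

open Presburger

theorem Valid.cost_clause_le (hx : x.Valid) {s : ℕ × List (List ℤ)} {b : List (List LinIneq)}
    (hb : b ∈ x.clauses s) {R : ℕ} (h1 : 1 ≤ R) (hd : x.dim ≤ R) (hS : x.numVertices ≤ R)
    (hE : x.numEdges ≤ R) (hK : x.bits ≤ R) : cost (disjConjTokens b) ≤ 2000 * R ^ 5 := by
  have hfit := hx.clauseFits b hb
  have p2 : 1 ≤ R ^ 2 := Nat.one_le_pow _ _ h1
  have p4 : 1 ≤ R ^ 4 := Nat.one_le_pow _ _ h1
  have p5 : 1 ≤ R ^ 5 := Nat.one_le_pow _ _ h1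
  have p12 : R ≤ R ^ 2 := Nat.le_self_pow (by norm_num) R
  have hB : x.numBase ≤ 2 * R := by rw [numBase]; omega
  have hKB : x.bits * x.numBase ≤ 2 * R ^ 2 :=
    (Nat.mul_le_mul hK hB).trans_eq (by ring)
  have hn : x.numBound ≤ 5 * R ^ 2 := by
    have : x.numBound = x.bits * x.numBase + x.numBase + x.numVertices := by
      rw [numBound, Nat.succ_mul]
    omega
  have hterm : ∀ l, x.TermFits l → cost (linTermTokens l) ≤ 90 * R ^ 4 := by
    intro l hl
    refine (cost_linTermTokens_le hl.inRange hl.length_le).trans ?_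
    have := Nat.mul_le_mul (show 2 + x.bits * x.numBase + x.numEdges ≤ 5 * R ^ 2 by omega)
      (show x.dim + x.numBound + 11 ≤ 17 * R ^ 2 by omega)
    have e : 5 * R ^ 2 * (17 * R ^ 2) = 85 * R ^ 4 := by ring
    omega
  have hconj : ∀ c ∈ b, cost (conjTokens c) ≤ 395 * R ^ 4 := by
    intro c hc
    have := cost_conj_le (l := c) (f := linIneqTokens) fun i hi =>
      have hi := hfit.term c hc i hi
      cost_linIneqTokens_le (hterm _ hi.1) (hterm _ hi.2)
    have h2 := Nat.mul_le_mul_right (2 * (90 * R ^ 4) + 5 + 5) (hfit.length_le_two c hc)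
    rw [conjTokens]
    omega
  refine (cost_disj_le hconj).trans ?_
  have := Nat.mul_le_mul (show b.length ≤ 3 * R by have := hfit.length_le; omega)
    (show 395 * R ^ 4 + 15 ≤ 410 * R ^ 4 by omega)
  have e : 3 * R * (410 * R ^ 4) = 1230 * R ^ 5 := by ring
  omega

/-- Every level of the system multiplies the cost by the number of its members. The numerical
constant is generous. -/
theorem Valid.cost_system_le (hx : x.Valid) {R : ℕ} (h1 : 1 ≤ R) (hd : x.dim ≤ R)
    (hS : x.numVertices ≤ R) (hE : x.numEdges ≤ R) (hK : x.bits ≤ R)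
    (hm : x.starts.length ≤ R) :
    cost (linFormulaTokens x.numBound x.system) ≤ 20000 * R ^ 8 := by
  have p2 : 1 ≤ R ^ 2 := Nat.one_le_pow _ _ h1
  have p5 : 1 ≤ R ^ 5 := Nat.one_le_pow _ _ h1
  have p7 : 1 ≤ R ^ 7 := Nat.one_le_pow _ _ h1
  have p12 : R ≤ R ^ 2 := Nat.le_self_pow (by norm_num) R
  have p28 : R ^ 2 ≤ R ^ 8 := Nat.pow_le_pow_right h1 (by norm_num)
  have hB : x.numBase ≤ 2 * R := by rw [numBase]; omega
  have hKB : x.bits * x.numBase ≤ 2 * R ^ 2 :=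
    (Nat.mul_le_mul hK hB).trans_eq (by ring)
  have hn : x.numBound ≤ 5 * R ^ 2 := by
    have : x.numBound = x.bits * x.numBase + x.numBase + x.numVertices := by
      rw [numBound, Nat.succ_mul]
    omega
  have hclauses : ∀ a ∈ x.system, cost (conjDisjConjTokens a) ≤ 14050 * R ^ 7 := by
    intro a ha
    obtain ⟨s, -, rfl⟩ := List.mem_map.1 ha
    have h2 := cost_conj_le (l := x.clauses s) fun b hb => hx.cost_clause_le hb h1 hd hS hE hK
    have h3 := Nat.mul_le_mul
      (show (x.clauses s).length ≤ 7 * R ^ 2 by rw [length_clauses]; omega)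
      (show 2000 * R ^ 5 + 5 ≤ 2005 * R ^ 5 by omega)
    have e : 7 * R ^ 2 * (2005 * R ^ 5) = 14035 * R ^ 7 := by ring
    rw [conjDisjConjTokens]
    omega
  have hbody : cost (linBodyTokens x.system) ≤ 14070 * R ^ 8 := by
    refine (cost_disj_le hclauses).trans ?_
    have h3 := Nat.mul_le_mul (show x.system.length ≤ R by simpa [system] using hm)
      (show 14050 * R ^ 7 + 15 ≤ 14065 * R ^ 7 by omega)
    have e : R * (14065 * R ^ 7) = 14065 * R ^ 8 := by ring
    omega
  have hq : cost ((List.range x.numBound).flatMap fun _ => [3, 4, 3]) ≤ x.numBound * 15 := by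
    refine (cost_flatMap_le (m := 15) fun _ _ => ?_).trans_eq (by rw [List.length_range])
    have := size_le_four (k := 3) (by norm_num)
    have := size_le_four (k := 4) (by norm_num)
    rw [cost_cons, cost_cons, cost_cons, cost_nil]
    omega
  have hq' : cost ((List.range x.numBound).flatMap fun _ => [0, 0]) ≤ x.numBound * 15 := by
    refine (cost_flatMap_le (m := 15) fun _ _ => ?_).trans_eq (by rw [List.length_range])
    simp [cost]
  rw [linFormulaTokens, cost_append, cost_append]
  omega

end WalkProblem

/-! ### Computing the matrix monoid -/

section Enumerate

variable {β : Type*} [DecidableEq β]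

/-- Append `a` to `L` unless it occurs in `L`. -/
def addNew (L : List β) (a : β) : List β := if L.length ≤ L.idxOf a then L ++ [a] else L

theorem addNew_eq (L : List β) (a : β) : addNew L a = if a ∈ L then L else L ++ [a] := by
  rw [addNew]
  by_cases h : a ∈ L
  · rw [if_neg (not_le.2 (List.idxOf_lt_length_iff.2 h)), if_pos h]
  · rw [if_pos (List.idxOf_eq_length h).ge, if_neg h]

theorem prefix_foldl_addNew (c : List β) : ∀ L : List β, L <+: c.foldl addNew L := by
  induction c with
  | nil => exact fun L => List.prefix_refl L
  | cons a c ih =>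
    intro L
    refine List.IsPrefix.trans ?_ (ih _)
    rw [addNew_eq]
    split_ifs
    · exact List.prefix_refl L
    · exact List.prefix_append L _

theorem mem_foldl_addNew (c : List β) : ∀ (L : List β) {b : β},
    b ∈ c.foldl addNew L ↔ b ∈ L ∨ b ∈ c := by
  induction c with
  | nil => simp
  | cons a c ih =>
    intro L b
    rw [List.foldl_cons, ih, addNew_eq]
    split_ifs with h
    · simp only [List.mem_cons]
      constructor
      · tauto
      · rintro (h' | rfl | h') <;> tauto
    · simp only [List.mem_append, List.mem_cons, List.not_mem_nil, or_false, or_assoc]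

theorem nodup_foldl_addNew (c : List β) : ∀ {L : List β}, L.Nodup → (c.foldl addNew L).Nodup := by
  induction c with
  | nil => exact fun h => h
  | cons a c ih =>
    intro L h
    refine ih ?_
    rw [addNew_eq]
    split_ifs with ha
    · exact h
    · exact List.nodup_append.2 ⟨h, List.nodup_singleton a, by
        rintro b hb c hc rfl
        exact ha (List.mem_singleton.1 hc ▸ hb)⟩

end Enumerate

/-- The list of rows of a matrix. -/
def matCode {d : ℕ} (A : Matrix (Fin d) (Fin d) ℤ) : List (List ℤ) :=
  List.ofFn fun i => List.ofFn fun j => A i j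

/-- The product of two `d × d` matrices given by their rows. -/
def mulCode (d : ℕ) (X Y : List (List ℤ)) : List (List ℤ) :=
  (List.range d).map fun i => (List.range d).map fun j =>
    ((List.range d).map fun k => matEntry X i k * matEntry Y k j).sum

/-- The product of a `d × d` matrix given by its rows and a vector. -/
def mulVecCode (d : ℕ) (X : List (List ℤ)) (b : List ℤ) : List ℤ :=
  (List.range d).map fun i => ((List.range d).map fun k => matEntry X i k * b.getD k 0).sum

/-- The rows of the identity matrix. -/
def oneCode (d : ℕ) : List (List ℤ) :=
  (List.range d).map fun i => (List.range d).map fun j => if i = j then 1 else 0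

theorem map_range_eq_ofFn {α : Type*} (d : ℕ) (f : ℕ → α) :
    (List.range d).map f = List.ofFn fun i : Fin d => f i :=
  List.ext_getElem (by simp) (by simp)

theorem getD_ofFn {d : ℕ} {α : Type*} (f : Fin d → α) (i : Fin d) (a : α) :
    (List.ofFn f).getD i a = f i := by
  simp [List.getD_eq_getElem?_getD]

theorem matEntry_matCode {d : ℕ} (A : Matrix (Fin d) (Fin d) ℤ) (i j : Fin d) :
    matEntry (matCode A) i j = A i j := by
  rw [matEntry, matCode, getD_ofFn, getD_ofFn]

theorem matCode_injective {d : ℕ} : Function.Injective (matCode (d := d)) := by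
  intro A B h
  ext i j
  rw [← matEntry_matCode A, h, matEntry_matCode]

theorem mulCode_matCode {d : ℕ} (A B : Matrix (Fin d) (Fin d) ℤ) :
    mulCode d (matCode A) (matCode B) = matCode (A * B) := by
  simp only [mulCode, map_range_eq_ofFn, List.sum_ofFn, matEntry_matCode]
  simp only [matCode, Matrix.mul_apply]

theorem mulVecCode_matCode {d : ℕ} (A : Matrix (Fin d) (Fin d) ℤ) (b : Fin d → ℤ) :
    mulVecCode d (matCode A) (List.ofFn b) = List.ofFn (A.mulVec b) := by
  simp only [mulVecCode, map_range_eq_ofFn, List.sum_ofFn, matEntry_matCode, getD_ofFn]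
  rfl

theorem oneCode_eq (d : ℕ) : oneCode d = matCode (1 : Matrix (Fin d) (Fin d) ℤ) := by
  simp only [oneCode, map_range_eq_ofFn, matCode, Matrix.one_apply, Fin.ext_iff]

namespace VASSInput

/-- The dimension. -/
def dim (x : VASSInput) : ℕ := x.1

/-- The number of states. -/
def numStates (x : VASSInput) : ℕ := x.2.1

/-- The list of transitions. -/
def transitions (x : VASSInput) : List TransitionCode := x.2.2.1

/-- The initial state. -/
def init (x : VASSInput) : ℕ := x.2.2.2.1

/-- The final state. -/
def final (x : VASSInput) : ℕ := x.2.2.2.2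

/-- The products of matrices of `L` with matrices of transitions. -/
def products (x : VASSInput) (L : List (List (List ℤ))) : List (List (List ℤ)) :=
  L.flatMap fun N => x.transitions.map fun t => mulCode x.dim N t.2.1

/-- `L` together with the products of its members with matrices of transitions. -/
def grow (x : VASSInput) (L : List (List (List ℤ))) : List (List (List ℤ)) :=
  (x.products L).foldl addNew L

/-- The products of at most `k` matrices of transitions. -/
def approx (x : VASSInput) (k : ℕ) : List (List (List ℤ)) := x.grow^[k] [oneCode x.dim]

/-- Products of `k + 1` matrices are products of `k` matrices already. -/
def stable (x : VASSInput) (k : ℕ) : Bool :=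
  decide ((x.approx (k + 1)).length = (x.approx k).length)

/-- The number of the vertex `(r, N)` of the product graph. -/
def vertex (L : List (List (List ℤ))) (r : ℕ) (N : List (List ℤ)) : ℕ :=
  r * L.length + L.idxOf N

/-- The edges of the product graph. -/
def productEdges (x : VASSInput) (L : List (List (List ℤ))) : List EdgeCode :=
  L.flatMap fun N => x.transitions.map fun t =>
    (vertex L t.1 (mulCode x.dim N t.2.1), vertex L t.2.2.2 N, mulVecCode x.dim N t.2.2.1)

/-- The walk problem in the product graph, when `L` lists the monoid. -/
def walkProblem (x : VASSInput) (L : List (List (List ℤ))) : WalkProblem :=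
  (x.dim, x.numStates * L.length, x.productEdges L, L.map fun N => (vertex L x.init N, N),
    vertex L x.final (oneCode x.dim))

/-- The tokens of the formula, when `L` lists the monoid. -/
def formulaTokens (x : VASSInput) (L : List (List (List ℤ))) : List ℕ :=
  Presburger.linFormulaTokens (x.walkProblem L).numBound (x.walkProblem L).system

/-- The algorithm: multiply matrices until no new products appear, and write down the formula of
the product graph. -/
def algorithm (x : VASSInput) : Part (List ℕ) :=
  (Nat.rfind fun k => Part.some (x.stable k)).map fun k => x.formulaTokens (x.approx k)

section Primrec

variable {α : Type*} [Primcodable α]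

@[fun_prop]
theorem primrec_addNew {β : Type*} [Primcodable β] [DecidableEq β] {f : α → List β} {g : α → β}
    (hf : Primrec f) (hg : Primrec g) : Primrec fun a => addNew (f a) (g a) := by
  unfold addNew
  fun_prop

@[fun_prop]
theorem primrec_mulCode {f : α → ℕ} {g : α → List (List ℤ)} {h : α → List (List ℤ)}
    (hf : Primrec f) (hg : Primrec g) (hh : Primrec h) :
    Primrec fun a => mulCode (f a) (g a) (h a) := by
  unfold mulCode
  fun_prop

@[fun_prop]
theorem primrec_mulVecCode {f : α → ℕ} {g : α → List (List ℤ)} {h : α → List ℤ}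
    (hf : Primrec f) (hg : Primrec g) (hh : Primrec h) :
    Primrec fun a => mulVecCode (f a) (g a) (h a) := by
  unfold mulVecCode
  fun_prop

@[fun_prop]
theorem primrec_oneCode {f : α → ℕ} (hf : Primrec f) :
    Primrec fun a => oneCode (f a) := by
  unfold oneCode
  fun_prop

@[fun_prop]
theorem primrec_dim {f : α → VASSInput} (hf : Primrec f) :
    Primrec fun a => dim (f a) := by
  unfold dim
  fun_prop

@[fun_prop]
theorem primrec_numStates {f : α → VASSInput} (hf : Primrec f) :
    Primrec fun a => numStates (f a) := by
  unfold numStates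
  fun_prop

@[fun_prop]
theorem primrec_transitions {f : α → VASSInput} (hf : Primrec f) :
    Primrec fun a => transitions (f a) := by
  unfold transitions
  fun_prop

@[fun_prop]
theorem primrec_init {f : α → VASSInput} (hf : Primrec f) :
    Primrec fun a => init (f a) := by
  unfold init
  fun_prop

@[fun_prop]
theorem primrec_final {f : α → VASSInput} (hf : Primrec f) :
    Primrec fun a => final (f a) := by
  unfold final
  fun_prop

@[fun_prop]
theorem primrec_products {f : α → VASSInput} {g : α → List (List (List ℤ))}
    (hf : Primrec f) (hg : Primrec g) :
    Primrec fun a => products (f a) (g a) := by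
  unfold products
  fun_prop

@[fun_prop]
theorem primrec_grow {f : α → VASSInput} {g : α → List (List (List ℤ))}
    (hf : Primrec f) (hg : Primrec g) :
    Primrec fun a => grow (f a) (g a) := by
  unfold grow
  fun_prop

@[fun_prop]
theorem primrec_approx {f : α → VASSInput} {g : α → ℕ} (hf : Primrec f) (hg : Primrec g) :
    Primrec fun a => approx (f a) (g a) := by
  unfold approx
  fun_prop

@[fun_prop]
theorem primrec_stable {f : α → VASSInput} {g : α → ℕ} (hf : Primrec f) (hg : Primrec g) :
    Primrec fun a => stable (f a) (g a) := by
  unfold stable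
  fun_prop

@[fun_prop]
theorem primrec_vertex {f : α → List (List (List ℤ))} {g : α → ℕ} {h : α → List (List ℤ)}
    (hf : Primrec f) (hg : Primrec g) (hh : Primrec h) :
    Primrec fun a => vertex (f a) (g a) (h a) := by
  unfold vertex
  fun_prop

@[fun_prop]
theorem primrec_productEdges {f : α → VASSInput} {g : α → List (List (List ℤ))}
    (hf : Primrec f) (hg : Primrec g) :
    Primrec fun a => productEdges (f a) (g a) := by
  unfold productEdges
  fun_prop

@[fun_prop]
theorem primrec_walkProblem {f : α → VASSInput} {g : α → List (List (List ℤ))}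
    (hf : Primrec f) (hg : Primrec g) :
    Primrec fun a => walkProblem (f a) (g a) := by
  unfold walkProblem
  fun_prop

@[fun_prop]
theorem primrec_formulaTokens {f : α → VASSInput} {g : α → List (List (List ℤ))}
    (hf : Primrec f) (hg : Primrec g) :
    Primrec fun a => formulaTokens (f a) (g a) := by
  unfold formulaTokens
  fun_prop

end Primrec

theorem partrec_algorithm : Partrec algorithm := by
  have h1 : Primrec fun y : VASSInput × ℕ => y.1.stable y.2 := by fun_prop
  have h2 : Primrec fun y : VASSInput × ℕ => y.1.formulaTokens (y.1.approx y.2) := by fun_prop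
  have h3 : Partrec₂ fun (x : VASSInput) (k : ℕ) => Part.some (x.stable k) := h1.to_comp.partrec
  have h4 : Computable₂ fun (x : VASSInput) (k : ℕ) => x.formulaTokens (x.approx k) := h2.to_comp
  exact (Partrec.rfind h3).map h4

end VASSInput

/-! ### Correctness of the algorithm -/

namespace AffineZVASS

variable {d : ℕ} {Q : Type u}

/-- The pairs of an element of `Ms` and a transition. -/
def edgePairs (Ms : List (Matrix (Fin d) (Fin d) ℤ)) (l : List (AffTransition d Q)) :
    List (Matrix (Fin d) (Fin d) ℤ × AffTransition d Q) :=
  Ms.flatMap fun N => l.map fun t => (N, t)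

theorem mem_edgePairs {Ms : List (Matrix (Fin d) (Fin d) ℤ)} {l : List (AffTransition d Q)}
    {y : Matrix (Fin d) (Fin d) ℤ × AffTransition d Q} :
    y ∈ edgePairs Ms l ↔ y.1 ∈ Ms ∧ y.2 ∈ l := by
  simp only [edgePairs, List.mem_flatMap, List.mem_map]
  constructor
  · rintro ⟨N, hN, t, ht, rfl⟩
    exact ⟨hN, ht⟩
  · exact fun ⟨h1, h2⟩ => ⟨y.1, h1, y.2, h2, rfl⟩

theorem length_edgePairs (Ms : List (Matrix (Fin d) (Fin d) ℤ)) (l : List (AffTransition d Q)) :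
    (edgePairs Ms l).length = Ms.length * l.length := by
  simp [edgePairs, List.length_flatMap]

variable [Fintype Q]

/-- `x` is the input that presents `V`, `p` and `q` with the numbering `e` of the states and the
list `l` of the transitions. -/
structure Presents (V : AffineZVASS d Q) (p q : Q) (e : Q ≃ Fin (Fintype.card Q))
    (l : List (AffTransition d Q)) (x : VASSInput) : Prop where
  nodup : l.Nodup
  mem_iff : ∀ t, t ∈ l ↔ t ∈ V.T
  eq : x = (d, Fintype.card Q, l.map (AffTransition.code e), (e p : ℕ), (e q : ℕ))

variable {V : AffineZVASS d Q} {p q : Q} {e : Q ≃ Fin (Fintype.card Q)}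
  {l : List (AffTransition d Q)} {x : VASSInput}

namespace Presents

theorem dim_eq (h : V.Presents p q e l x) : VASSInput.dim x = d := by rw [h.eq]; rfl

theorem transitions_eq (h : V.Presents p q e l x) :
    VASSInput.transitions x = l.map (AffTransition.code e) := by rw [h.eq]; rfl

theorem length_eq (h : V.Presents p q e l x) : l.length = V.T.card := by
  classical
  rw [← List.toFinset_card_of_nodup h.nodup]
  congr 1
  ext t
  rw [List.mem_toFinset, h.mem_iff]

theorem products_map (h : V.Presents p q e l x) (Ms : List (Matrix (Fin d) (Fin d) ℤ)) :
    VASSInput.products x (Ms.map matCode) =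
      (Ms.flatMap fun N => l.map fun t => N * t.mat).map matCode := by
  rw [VASSInput.products, h.transitions_eq, h.dim_eq, List.flatMap_map, List.map_flatMap]
  refine List.flatMap_congr fun N _ => ?_
  rw [List.map_map, List.map_map]
  exact List.map_congr_left fun t _ => mulCode_matCode N t.mat

/-- The approximations list distinct elements of the monoid, the identity among them. -/
theorem approx_eq (h : V.Presents p q e l x) (k : ℕ) :
    ∃ Ms : List (Matrix (Fin d) (Fin d) ℤ), VASSInput.approx x k = Ms.map matCode ∧ Ms.Nodup ∧
      1 ∈ Ms ∧ ∀ A ∈ Ms, A ∈ V.monoid := by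
  induction k with
  | zero =>
    refine ⟨[1], ?_, List.nodup_singleton _, List.mem_singleton_self _, ?_⟩
    · simp [VASSInput.approx, h.dim_eq, oneCode_eq]
    · simp
  | succ k ih =>
    obtain ⟨Ms, hMs, hnodup, hone, hmem⟩ := ih
    have happ : VASSInput.approx x (k + 1) =
        (VASSInput.products x (Ms.map matCode)).foldl addNew (Ms.map matCode) := by
      rw [← hMs, VASSInput.approx, Function.iterate_succ_apply']
      rfl
    rw [h.products_map] at happ
    have hsub : ∀ c ∈ VASSInput.approx x (k + 1), ∃ A ∈ V.monoid, matCode A = c := by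
      intro c hc
      rw [happ, mem_foldl_addNew] at hc
      rcases hc with hc | hc
      · obtain ⟨A, hA, rfl⟩ := List.mem_map.1 hc
        exact ⟨A, hmem A hA, rfl⟩
      · obtain ⟨A, hA, rfl⟩ := List.mem_map.1 hc
        obtain ⟨N, hN, hA⟩ := List.mem_flatMap.1 hA
        obtain ⟨t, ht, rfl⟩ := List.mem_map.1 hA
        exact ⟨_, V.monoid.mul_mem (hmem N hN) (mat_mem_monoid ((h.mem_iff t).1 ht)), rfl⟩
    obtain ⟨Ms', hMs'⟩ : ∃ Ms', List.map matCode Ms' = VASSInput.approx x (k + 1) := by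
      have : VASSInput.approx x (k + 1) ∈ Set.range (List.map (matCode (d := d))) := by
        rw [Set.range_list_map]
        exact fun c hc => (hsub c hc).imp fun A hA => hA.2
      exact this
    refine ⟨Ms', hMs'.symm, ?_, ?_, fun A hA => ?_⟩
    · have hn := nodup_foldl_addNew ((Ms.flatMap fun N => l.map fun t => N * t.mat).map matCode)
        (hnodup.map matCode_injective)
      rw [← happ, ← hMs'] at hn
      exact hn.of_map _
    · refine (List.mem_map_of_injective matCode_injective).1 ?_
      rw [hMs', happ, mem_foldl_addNew]
      exact .inl (List.mem_map_of_mem hone)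
    · obtain ⟨B, hB, hBA⟩ := hsub (matCode A) (hMs' ▸ List.mem_map_of_mem hA)
      exact matCode_injective hBA ▸ hB

theorem approx_length_le (h : V.Presents p q e l x) (hV : V.FiniteMonoid) (k : ℕ) :
    (VASSInput.approx x k).length ≤ Nat.card V.monoid := by
  classical
  obtain ⟨Ms, hMs, hnodup, -, hmem⟩ := h.approx_eq k
  rw [hMs, List.length_map, ← List.toFinset_card_of_nodup hnodup, ← Set.ncard_coe_finset]
  exact Set.ncard_le_ncard (fun A hA => hmem A (by simpa using hA)) hV

theorem exists_stable (h : V.Presents p q e l x) (hV : V.FiniteMonoid) :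
    ∃ k, VASSInput.stable x k = true := by
  by_contra! hne
  -- otherwise the approximations grow for ever
  have hlt : ∀ k, k ≤ (VASSInput.approx x k).length := by
    intro k
    induction k with
    | zero => exact Nat.zero_le _
    | succ k ih =>
      have h1 : (VASSInput.approx x (k + 1)).length ≠ (VASSInput.approx x k).length := by
        simpa [VASSInput.stable] using hne k
      have h2 : (VASSInput.approx x k).length ≤ (VASSInput.approx x (k + 1)).length := by
        rw [VASSInput.approx, VASSInput.approx, Function.iterate_succ_apply']
        exact (prefix_foldl_addNew _ _).length_le
      omega
  have := (hlt (Nat.card V.monoid + 1)).trans (h.approx_length_le hV _)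
  omega

/-- A stable approximation is closed under multiplication by the generators, and hence lists the
whole monoid. -/
theorem approx_of_stable (h : V.Presents p q e l x) {k : ℕ} (hk : VASSInput.stable x k = true) :
    ∃ Ms : List (Matrix (Fin d) (Fin d) ℤ), VASSInput.approx x k = Ms.map matCode ∧ Ms.Nodup ∧
      ∀ A, A ∈ Ms ↔ A ∈ V.monoid := by
  obtain ⟨Ms, hMs, hnodup, hone, hmem⟩ := h.approx_eq k
  refine ⟨Ms, hMs, hnodup, fun A => ⟨hmem A, fun hA => ?_⟩⟩
  have happ : VASSInput.approx x (k + 1) =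
      (VASSInput.products x (Ms.map matCode)).foldl addNew (Ms.map matCode) := by
    rw [← hMs, VASSInput.approx, Function.iterate_succ_apply']
    rfl
  have heq : Ms.map matCode = VASSInput.approx x (k + 1) := by
    rw [happ]
    refine (prefix_foldl_addNew _ _).eq_of_length ?_
    rw [← happ, ← hMs]
    exact (of_decide_eq_true hk).symm
  induction hA using Submonoid.closure_induction_right with
  | one => exact hone
  | mul_right N _ B hB ih =>
    obtain ⟨t, ht, rfl⟩ := hB
    refine (List.mem_map_of_injective matCode_injective).1 ?_
    rw [heq, happ, mem_foldl_addNew, h.products_map]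
    exact .inr (List.mem_map_of_mem (List.mem_flatMap.2
      ⟨N, ih, List.mem_map_of_mem ((h.mem_iff t).2 ht)⟩))

end Presents

/-- The code of a product edge. -/
def edgeCode (e : Q ≃ Fin (Fintype.card Q)) (Ms : List (Matrix (Fin d) (Fin d) ℤ))
    (y : Matrix (Fin d) (Fin d) ℤ × AffTransition d Q) : EdgeCode :=
  (VASSInput.vertex (Ms.map matCode) (e y.2.src) (matCode (y.1 * y.2.mat)),
    VASSInput.vertex (Ms.map matCode) (e y.2.tgt) (matCode y.1), List.ofFn (y.1.mulVec y.2.vec))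

namespace Presents

variable {Ms : List (Matrix (Fin d) (Fin d) ℤ)}

theorem walkProblem_eq (h : V.Presents p q e l x) : VASSInput.walkProblem x (Ms.map matCode) =
    (d, Fintype.card Q * Ms.length, (edgePairs Ms l).map (edgeCode e Ms),
      Ms.map fun N => (VASSInput.vertex (Ms.map matCode) (e p) (matCode N), matCode N),
      VASSInput.vertex (Ms.map matCode) (e q) (matCode (1 : Matrix (Fin d) (Fin d) ℤ))) := by
  have hedges : VASSInput.productEdges x (Ms.map matCode) =
      (edgePairs Ms l).map (edgeCode e Ms) := by
    rw [VASSInput.productEdges, h.transitions_eq, h.dim_eq, List.flatMap_map, edgePairs,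
      List.map_flatMap]
    refine List.flatMap_congr fun N _ => ?_
    rw [List.map_map, List.map_map]
    refine List.map_congr_left fun t _ => ?_
    simp only [Function.comp_apply, AffTransition.code, edgeCode, ← mulCode_matCode,
      ← mulVecCode_matCode]
    rfl
  rw [VASSInput.walkProblem, hedges, h.dim_eq, List.map_map, List.length_map, oneCode_eq]
  rw [h.eq]
  rfl

theorem vertex_lt {Ms : List (Matrix (Fin d) (Fin d) ℤ)} {N : Matrix (Fin d) (Fin d) ℤ}
    (hN : N ∈ Ms) (r : Q) :
    VASSInput.vertex (Ms.map matCode) (e r) (matCode N) < Fintype.card Q * Ms.length := by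
  have h1 := List.idxOf_lt_length_iff.2 (List.mem_map_of_mem (f := matCode) hN)
  have h2 := Nat.mul_le_mul_right Ms.length (Nat.succ_le_of_lt (e r).2)
  rw [List.length_map] at h1
  rw [VASSInput.vertex, List.length_map]
  rw [Nat.succ_mul] at h2
  omega

theorem vertex_injOn (e : Q ≃ Fin (Fintype.card Q)) (Ms : List (Matrix (Fin d) (Fin d) ℤ)) :
    {y : Q × Matrix (Fin d) (Fin d) ℤ | y.2 ∈ Ms}.InjOn
      fun y => VASSInput.vertex (Ms.map matCode) (e y.1) (matCode y.2) := by
  rintro ⟨r, N⟩ hN ⟨r', N'⟩ hN' heq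
  have h1 := List.idxOf_lt_length_iff.2 (List.mem_map_of_mem (f := matCode) hN)
  have h2 := List.idxOf_lt_length_iff.2 (List.mem_map_of_mem (f := matCode) hN')
  simp only [VASSInput.vertex] at heq
  obtain ⟨hr, hidx⟩ : (e r : ℕ) = e r' ∧
      (Ms.map matCode).idxOf (matCode N) = (Ms.map matCode).idxOf (matCode N') := by
    have hmod := congrArg (· % (Ms.map matCode).length) heq
    simp only [Nat.mul_add_mod_self_right, Nat.mod_eq_of_lt h1, Nat.mod_eq_of_lt h2] at hmod
    refine ⟨?_, hmod⟩
    have hpos : 0 < (Ms.map matCode).length := by omega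
    exact Nat.eq_of_mul_eq_mul_right hpos (by omega)
  have hN'' : matCode N = matCode N' :=
    (List.idxOf_inj (List.mem_map_of_mem (f := matCode) hN)).1 hidx
  rw [e.injective (Fin.ext hr), matCode_injective hN'']

theorem numEdges_eq (h : V.Presents p q e l x) :
    (VASSInput.walkProblem x (Ms.map matCode)).numEdges = (edgePairs Ms l).length := by
  rw [h.walkProblem_eq]
  exact List.length_map _

theorem getD_edges (h : V.Presents p q e l x) {i : ℕ} (hi : i < (edgePairs Ms l).length) :
    (VASSInput.walkProblem x (Ms.map matCode)).edges.getD i (0, 0, []) =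
      edgeCode e Ms (edgePairs Ms l)[i] := by
  rw [h.walkProblem_eq]
  change ((edgePairs Ms l).map (edgeCode e Ms)).getD i (0, 0, []) = _
  rw [List.getD_eq_getElem _ _ (by simpa using hi), List.getElem_map]

theorem valid (h : V.Presents p q e l x) (hMs : ∀ A, A ∈ Ms ↔ A ∈ V.monoid) :
    (VASSInput.walkProblem x (Ms.map matCode)).Valid := by
  have hS : (VASSInput.walkProblem x (Ms.map matCode)).numVertices =
      Fintype.card Q * Ms.length := by
    rw [h.walkProblem_eq]
    rfl
  have hmem : ∀ i (hi : i < (edgePairs Ms l).length),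
      (edgePairs Ms l)[i].1 ∈ V.monoid ∧ (edgePairs Ms l)[i].2 ∈ V.T := fun i hi => by
    obtain ⟨h1, h2⟩ := mem_edgePairs.1 (List.getElem_mem hi)
    exact ⟨(hMs _).1 h1, (h.mem_iff _).1 h2⟩
  constructor
  · intro i hi
    rw [h.numEdges_eq] at hi
    rw [WalkProblem.src, h.getD_edges hi, hS]
    obtain ⟨h1, h2⟩ := hmem i hi
    exact vertex_lt ((hMs _).2 (V.monoid.mul_mem h1 (mat_mem_monoid h2))) _
  · intro i hi
    rw [h.numEdges_eq] at hi
    rw [WalkProblem.tgt, h.getD_edges hi, hS]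
    exact vertex_lt ((hMs _).2 (hmem i hi).1) _
  · intro s hs
    rw [h.walkProblem_eq] at hs
    obtain ⟨N, hN, rfl⟩ := List.mem_map.1 hs
    rw [hS]
    exact vertex_lt hN _
  · rw [hS, h.walkProblem_eq]
    exact vertex_lt ((hMs 1).2 V.monoid.one_mem) _

theorem isSolution_iff (h : V.Presents p q e l x) (hMs : ∀ A, A ∈ Ms ↔ A ∈ V.monoid)
    (u v : Fin d → ℤ) :
    (VASSInput.walkProblem x (Ms.map matCode)).IsSolution (extend u) (extend v) ↔
      V.Reach (p, u) (q, v) := by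
  set y := VASSInput.walkProblem x (Ms.map matCode) with hy
  let pair (i : Fin y.numEdges) : Matrix (Fin d) (Fin d) ℤ × AffTransition d Q :=
    (edgePairs Ms l)[i]'(i.2.trans_eq h.numEdges_eq)
  have hpair : ∀ i : Fin y.numEdges, y.edges.getD i (0, 0, []) = edgeCode e Ms (pair i) :=
    fun i => h.getD_edges (i.2.trans_eq h.numEdges_eq)
  let τ (i : Fin y.numEdges) : AffTransition d Q := (pair i).2
  let N (i : Fin y.numEdges) : Matrix (Fin d) (Fin d) ℤ := (pair i).1
  have hE : ProductEdges V τ N := by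
    refine ⟨fun i => ?_, fun i => ?_, fun t ht A hA => ?_⟩
    · exact (h.mem_iff _).1 (mem_edgePairs.1 (List.getElem_mem _)).2
    · exact (hMs _).1 (mem_edgePairs.1 (List.getElem_mem _)).1
    · obtain ⟨i, hi, heq⟩ := List.getElem_of_mem
        (mem_edgePairs.2 ⟨(hMs A).2 hA, (h.mem_iff t).2 ht⟩ : (A, t) ∈ edgePairs Ms l)
      exact ⟨⟨i, hi.trans_eq h.numEdges_eq.symm⟩, congrArg Prod.snd heq, congrArg Prod.fst heq⟩
  let g (z : Q × Matrix (Fin d) (Fin d) ℤ) : ℕ :=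
    VASSInput.vertex (Ms.map matCode) (e z.1) (matCode z.2)
  have hsrc : y.srcFin = fun i => g (prodSrc τ N i) := by
    funext i
    rw [WalkProblem.srcFin, WalkProblem.src, hpair]
    rfl
  have htgt : y.tgtFin = fun i => g (prodTgt τ N i) := by
    funext i
    rw [WalkProblem.tgtFin, WalkProblem.tgt, hpair]
    rfl
  have hvec : ∀ (i : Fin y.numEdges) (j : Fin d), y.vec i j = prodVec τ N i j := by
    intro i j
    rw [WalkProblem.vec, hpair, edgeCode, getD_ofFn]
    rfl
  have hdim : y.dim = d := by rw [hy, h.walkProblem_eq]; rfl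
  have hstarts : y.starts = Ms.map fun A => (g (p, A), matCode A) := by
    rw [hy, h.walkProblem_eq]; rfl
  have hfinal : y.final = g (q, 1) := by rw [hy, h.walkProblem_eq]; rfl
  have hwalk : ∀ {A} (_ : A ∈ Ms) (w : List (Fin y.numEdges)),
      IsWalk y.srcFin y.tgtFin (g (p, A)) w y.final ↔
        IsWalk (prodSrc τ N) (prodTgt τ N) (p, A) w (q, 1) := by
    intro A hA w
    rw [hsrc, htgt, hfinal]
    exact IsWalk.map_iff (vertex_injOn e Ms) (fun i => (hMs _).2 (hE.src_mem i))
      (fun i => (hMs _).2 (hE.mem_monoid i)) ((hMs 1).2 V.monoid.one_mem) w hA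
  have hext : ∀ (a : Fin d → ℤ) (j : Fin d), extend a j = a j := fun a j => by simp [extend]
  have heffect : ∀ A (w : List (Fin y.numEdges)),
      (∀ i < y.dim, extend v i = ∑ j ∈ Finset.range y.dim, matEntry (matCode A) i j * extend u j +
        (w.map fun b : Fin y.numEdges => y.vec b i).sum) ↔
      v = A.mulVec u + (w.map (prodVec τ N)).sum := by
    intro A w
    rw [hdim, funext_iff, Fin.forall_iff]
    refine forall₂_congr fun i hi => ?_
    have h1 := hext v ⟨i, hi⟩
    have h2 : (w.map fun b : Fin y.numEdges => y.vec b i) =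
        w.map fun b => prodVec τ N b ⟨i, hi⟩ := List.map_congr_left fun b _ => hvec b ⟨i, hi⟩
    have h3 : ((w.map (prodVec τ N)).sum : Fin d → ℤ) ⟨i, hi⟩ =
        (w.map fun b => prodVec τ N b ⟨i, hi⟩).sum := by
      refine (map_list_sum (Pi.evalAddMonoidHom (fun _ : Fin d => ℤ) ⟨i, hi⟩) _).trans ?_
      rw [List.map_map]
      rfl
    have h4 : ∑ j ∈ Finset.range d, matEntry (matCode A) i j * extend u j =
        A.mulVec u ⟨i, hi⟩ := by
      rw [Finset.sum_range]
      exact Finset.sum_congr rfl fun j _ =>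
        congrArg₂ (· * ·) (matEntry_matCode A ⟨i, hi⟩ j) (hext u j)
    dsimp only at h1
    rw [h1, h2, h4, Pi.add_apply, h3]
  rw [WalkProblem.IsSolution, hE.reach_iff, hstarts]
  simp only [List.mem_map, exists_exists_and_eq_and, heffect]
  constructor
  · rintro ⟨A, hA, w, hw, hv⟩
    exact ⟨A, (hMs A).1 hA, w, (hwalk hA w).1 hw, hv⟩
  · rintro ⟨A, hA, w, hw, hv⟩
    exact ⟨A, (hMs A).2 hA, w, (hwalk ((hMs A).2 hA) w).2 hw, hv⟩

end Presents

end AffineZVASS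

/-! ### The size of the output -/

theorem Nat.size_mul_le (a b : ℕ) : (a * b).size ≤ a.size + b.size := by
  rw [Nat.size_le, pow_add]
  exact Nat.mul_lt_mul'' (Nat.size_le.1 le_rfl) (Nat.size_le.1 le_rfl)

theorem Nat.size_le_log_add_one (n : ℕ) : n.size ≤ Nat.log 2 n + 1 :=
  Nat.size_le.2 (Nat.lt_pow_succ_log_self (by norm_num) n)

theorem natAbs_le_matNorm {d : ℕ} (A : Matrix (Fin d) (Fin d) ℤ) (i j : Fin d) :
    (A i j).natAbs ≤ matNorm A :=
  (Finset.le_sup (f := fun j => (A i j).natAbs) (Finset.mem_univ j)).trans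
    (Finset.le_sup (f := fun i => Finset.univ.sup fun j => (A i j).natAbs) (Finset.mem_univ i))

namespace AffineZVASS

variable {d : ℕ} {Q : Type u} {V : AffineZVASS d Q}

theorem natAbs_vec_le_normT {t : AffTransition d Q} (ht : t ∈ V.T) (i : Fin d) :
    (t.vec i).natAbs ≤ V.normT :=
  (Finset.le_sup (f := fun i => (t.vec i).natAbs) (Finset.mem_univ i)).trans <|
    (le_max_left (vecNorm t.vec) (matNorm t.mat)).trans
      (Finset.le_sup (f := fun t : AffTransition d Q => max (vecNorm t.vec) (matNorm t.mat)) ht)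

theorem matNorm_le_matSetNorm (hV : V.FiniteMonoid) {A : Matrix (Fin d) (Fin d) ℤ}
    (hA : A ∈ V.monoid) : matNorm A ≤ matSetNorm (V.monoid : Set (Matrix (Fin d) (Fin d) ℤ)) :=
  le_csSup (hV.image matNorm).bddAbove ⟨A, hA, rfl⟩

variable [Fintype Q]

/-- A quantity that bounds the dimension, the number of states, the cardinality of the monoid and
the number of bits of its entries. -/
noncomputable def measure (V : AffineZVASS d Q) : ℕ :=
  V.size + Nat.card V.monoid +
    Nat.log 2 (matSetNorm (V.monoid : Set (Matrix (Fin d) (Fin d) ℤ))) + 2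

theorem dim_le_measure : d ≤ V.measure := by
  rw [measure, size]; omega

theorem card_le_measure : Fintype.card Q ≤ V.measure := by
  rw [measure, size]; omega

/-- In positive dimension the size of `V` accounts for the number of transitions; in dimension
zero a transition is determined by its two states. -/
theorem card_T_le : V.T.card ≤ V.measure ^ 2 := by
  rcases Nat.eq_zero_or_pos d with rfl | hd
  · have : V.T.card ≤ Fintype.card (Q × Q) := by
      refine Finset.card_le_card_of_injOn (t := Finset.univ) (fun t => (t.src, t.tgt))
        (fun _ _ => Finset.mem_coe.2 (Finset.mem_univ _)) ?_
      rintro ⟨s, A, b, t⟩ - ⟨s', A', b', t'⟩ - h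
      obtain ⟨rfl, rfl⟩ := Prod.mk.inj h
      rw [Subsingleton.elim A A', Subsingleton.elim b b']
    rw [Fintype.card_prod] at this
    exact this.trans ((Nat.mul_le_mul card_le_measure card_le_measure).trans_eq (sq _).symm)
  · have h1 : V.T.card ≤ V.size := by
      rw [size]
      refine le_trans ?_ (Nat.le_add_left _ _)
      calc V.T.card = 1 * V.T.card * 1 := by ring
        _ ≤ (d ^ 2 + d) * V.T.card * max 1 (Nat.clog 2 (V.normT + 1)) :=
          Nat.mul_le_mul (Nat.mul_le_mul_right _ (Nat.le_add_left_of_le (Nat.succ_le_of_lt hd)))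
          (le_max_left _ _)
    calc V.T.card ≤ V.measure := by rw [measure]; omega
      _ ≤ V.measure ^ 2 := Nat.le_self_pow (by norm_num) _

theorem size_normT_le (hd : 0 < d) {t : AffTransition d Q} (ht : t ∈ V.T) :
    V.normT.size ≤ V.measure := by
  have h1 : V.normT.size ≤ Nat.clog 2 (V.normT + 1) :=
    Nat.size_le.2 (Nat.le_pow_clog (by norm_num) _)
  have h2 : 0 < V.T.card := Finset.card_pos.2 ⟨t, ht⟩
  have h3 : max 1 (Nat.clog 2 (V.normT + 1)) ≤ V.size := by
    rw [size]
    refine le_trans ?_ (Nat.le_add_left _ _)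
    exact Nat.le_mul_of_pos_left _ (by positivity)
  have h4 := le_max_right 1 (Nat.clog 2 (V.normT + 1))
  rw [measure]
  omega

theorem size_matSetNorm_le :
    (matSetNorm (V.monoid : Set (Matrix (Fin d) (Fin d) ℤ))).size ≤ V.measure := by
  refine (Nat.size_le_log_add_one _).trans ?_
  rw [measure]
  omega

theorem size_mat_le (hV : V.FiniteMonoid) {A : Matrix (Fin d) (Fin d) ℤ} (hA : A ∈ V.monoid)
    (i j : Fin d) : (A i j).natAbs.size ≤ 3 * V.measure := by
  have := Nat.size_le_size ((natAbs_le_matNorm A i j).trans (matNorm_le_matSetNorm hV hA))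
  have := size_matSetNorm_le (V := V)
  omega

theorem size_mulVec_le (hV : V.FiniteMonoid) {A : Matrix (Fin d) (Fin d) ℤ} (hA : A ∈ V.monoid)
    {t : AffTransition d Q} (ht : t ∈ V.T) (i : Fin d) :
    (A.mulVec t.vec i).natAbs.size ≤ 3 * V.measure := by
  have h1 : (A.mulVec t.vec i).natAbs ≤
      d * (matSetNorm (V.monoid : Set (Matrix (Fin d) (Fin d) ℤ)) * V.normT) := by
    refine (Int.natAbs_sum_le Finset.univ fun j => A i j * t.vec j).trans
      ((Finset.sum_le_card_nsmul _ _
      (matSetNorm (V.monoid : Set (Matrix (Fin d) (Fin d) ℤ)) * V.normT) fun j _ => ?_).trans_eq ?_)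
    · rw [Int.natAbs_mul]
      exact Nat.mul_le_mul ((natAbs_le_matNorm A i j).trans (matNorm_le_matSetNorm hV hA))
        (natAbs_vec_le_normT ht j)
    · simp
  have h2 := (Nat.size_le_size h1).trans (Nat.size_mul_le _ _)
  have h3 := Nat.size_mul_le (matSetNorm (V.monoid : Set (Matrix (Fin d) (Fin d) ℤ))) V.normT
  have h4 := size_normT_le i.pos ht
  have h5 := size_matSetNorm_le (V := V)
  have h6 := (Presburger.size_le_self d).trans (dim_le_measure (V := V))
  omega

namespace Presents

variable {p q : Q} {e : Q ≃ Fin (Fintype.card Q)} {l : List (AffTransition d Q)} {x : VASSInput}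
  {Ms : List (Matrix (Fin d) (Fin d) ℤ)}

theorem coeffs_eq (h : V.Presents p q e l x) :
    (VASSInput.walkProblem x (Ms.map matCode)).coeffs =
      ((edgePairs Ms l).flatMap fun y => List.ofFn (y.1.mulVec y.2.vec)) ++
        Ms.flatMap fun A => (matCode A).flatten := by
  rw [WalkProblem.coeffs, h.walkProblem_eq]
  change ((edgePairs Ms l).map (edgeCode e Ms)).flatMap _ ++ (Ms.map _).flatMap _ = _
  rw [List.flatMap_map, List.flatMap_map]
  rfl

theorem bits_le (h : V.Presents p q e l x) (hV : V.FiniteMonoid)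
    (hMs : ∀ A, A ∈ Ms ↔ A ∈ V.monoid) :
    (VASSInput.walkProblem x (Ms.map matCode)).bits ≤
      (Ms.length * V.T.card * d + Ms.length * (d * d)) * (3 * V.measure) := by
  have hsize : ∀ c ∈ (VASSInput.walkProblem x (Ms.map matCode)).coeffs,
      c.natAbs.size ≤ 3 * V.measure := by
    intro c hc
    rw [h.coeffs_eq] at hc
    rcases List.mem_append.1 hc with hc | hc
    · obtain ⟨y, hy, hc⟩ := List.mem_flatMap.1 hc
      obtain ⟨i, rfl⟩ := List.mem_ofFn.1 hc
      obtain ⟨h1, h2⟩ := mem_edgePairs.1 hy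
      exact size_mulVec_le hV ((hMs _).1 h1) ((h.mem_iff _).1 h2) i
    · obtain ⟨A, hA, hc⟩ := List.mem_flatMap.1 hc
      obtain ⟨r, hr, hc⟩ := List.mem_flatten.1 hc
      obtain ⟨i, rfl⟩ := List.mem_ofFn.1 hr
      obtain ⟨j, rfl⟩ := List.mem_ofFn.1 hc
      exact size_mat_le hV ((hMs A).1 hA) i j
  have hlen : (VASSInput.walkProblem x (Ms.map matCode)).coeffs.length ≤
      Ms.length * V.T.card * d + Ms.length * (d * d) := by
    rw [h.coeffs_eq, List.length_append, ← h.length_eq, ← length_edgePairs]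
    refine Nat.add_le_add (WalkProblem.length_flatMap_le fun y _ => by simp)
      (WalkProblem.length_flatMap_le fun A _ => ?_)
    simp [matCode, List.length_flatten, List.map_ofFn, Function.comp_def]
  rw [WalkProblem.bits]
  refine (List.sum_le_card_nsmul _ (3 * V.measure) ?_).trans ?_
  · intro k hk
    obtain ⟨c, hc, rfl⟩ := List.mem_map.1 hk
    exact hsize c hc
  · rw [List.length_map, smul_eq_mul]
    exact Nat.mul_le_mul_right _ hlen

/-- The exponent is `8 * 8`: the parameters of the walk problem are at most `V.measure ^ 8`, mainly
because of the number of bits of all coefficients, and the cost is of degree `8` in them. -/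
theorem cost_le (h : V.Presents p q e l x) (hV : V.FiniteMonoid)
    (hMs : ∀ A, A ∈ Ms ↔ A ∈ V.monoid) (hlen : Ms.length ≤ Nat.card V.monoid) :
    Presburger.cost (VASSInput.formulaTokens x (Ms.map matCode)) ≤
      20000 * V.measure ^ 64 := by
  have hm : Ms.length ≤ V.measure := by rw [measure]; omega
  have h2 : 2 ≤ V.measure := by rw [measure]; omega
  have h1 : 1 ≤ V.measure := by omega
  have hd := dim_le_measure (V := V)
  have hn := card_le_measure (V := V)
  have hT := card_T_le (V := V)
  have hbits := h.bits_le hV hMs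
  have hdim : (VASSInput.walkProblem x (Ms.map matCode)).dim = d := by
    rw [h.walkProblem_eq]; rfl
  have hS : (VASSInput.walkProblem x (Ms.map matCode)).numVertices =
      Fintype.card Q * Ms.length := by rw [h.walkProblem_eq]; rfl
  have hE : (VASSInput.walkProblem x (Ms.map matCode)).numEdges = Ms.length * V.T.card := by
    rw [h.numEdges_eq, length_edgePairs, h.length_eq]
  have hstarts : (VASSInput.walkProblem x (Ms.map matCode)).starts.length = Ms.length := by
    rw [h.walkProblem_eq]; exact List.length_map _
  generalize V.measure = R at *
  have p8 : ∀ k ≤ 8, R ^ k ≤ R ^ 8 := fun k hk => Nat.pow_le_pow_right h1 hk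
  have hR : R ≤ R ^ 8 := Nat.le_self_pow (by norm_num) R
  have hET : Ms.length * V.T.card ≤ R ^ 3 :=
    (Nat.mul_le_mul hm hT).trans_eq (by ring)
  have hcoeffs : Ms.length * V.T.card * d + Ms.length * (d * d) ≤ R ^ 4 + R ^ 3 :=
    Nat.add_le_add ((Nat.mul_le_mul hET hd).trans_eq (by ring))
      ((Nat.mul_le_mul hm (Nat.mul_le_mul hd hd)).trans_eq (by ring))
  have hbits' : (R ^ 4 + R ^ 3) * (3 * R) ≤ R ^ 8 :=
    calc (R ^ 4 + R ^ 3) * (3 * R) ≤ (R ^ 4 + R ^ 4) * (3 * R) :=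
          Nat.mul_le_mul_right _ (Nat.add_le_add_left (Nat.pow_le_pow_right h1 (by norm_num)) _)
      _ = 6 * R ^ 5 := by ring
      _ ≤ R ^ 3 * R ^ 5 := Nat.mul_le_mul_right _
          (le_trans (by norm_num) (Nat.pow_le_pow_left h2 3))
      _ = R ^ 8 := by ring
  refine ((h.valid hMs).cost_system_le (R := R ^ 8) (Nat.one_le_pow _ _ h1) ?_ ?_ ?_ ?_ ?_).trans_eq
    (by rw [← pow_mul])
  · rw [hdim]
    exact hd.trans hR
  · rw [hS]
    exact ((Nat.mul_le_mul hn hm).trans_eq (sq R).symm).trans (p8 2 (by norm_num))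
  · rw [hE]
    exact hET.trans (p8 3 (by norm_num))
  · exact hbits.trans ((Nat.mul_le_mul_right _ hcoeffs).trans hbits')
  · rw [hstarts]
    exact hm.trans hR

/-- On a presentation of `V`, the algorithm halts, and its output is an existential formula for the
reachability relation, of polynomial size. -/
theorem exists_formula (h : V.Presents p q e l x) (hV : V.FiniteMonoid) :
    ∃ φ : presburgerOrd.Formula (Fin d ⊕ Fin d),
      VASSInput.algorithm x = Part.some (Presburger.tokens φ) ∧ φ.IsExistential ∧
      Presburger.formulaSize φ ≤ 20000 * V.measure ^ 64 ∧
      ∀ u v : Fin d → ℤ, φ.Realize (Sum.elim u v) ↔ V.Reach (p, u) (q, v) := by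
  obtain ⟨k₀, hk₀⟩ := h.exists_stable hV
  obtain ⟨k, hk, -⟩ := Nat.rfind_min' hk₀
  have hstable : VASSInput.stable x k = true := by
    obtain ⟨_, h⟩ := Nat.rfind_spec hk
    exact h
  obtain ⟨Ms, happ, hnodup, hMs⟩ := h.approx_of_stable hstable
  have hlen : Ms.length ≤ Nat.card V.monoid := by
    have := h.approx_length_le hV k
    rwa [happ, List.length_map] at this
  have hvalid := h.valid hMs
  set y := VASSInput.walkProblem x (Ms.map matCode) with hy
  have hdim : y.dim = d := by rw [hy, h.walkProblem_eq]; rfl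
  have hrange : y.system.InRange d y.numBound := hdim ▸ hvalid.inRange_system
  have htokens : Presburger.tokens (Presburger.linFormula d y.numBound y.system) =
      VASSInput.formulaTokens x (Ms.map matCode) := Presburger.tokens_linFormula hrange
  refine ⟨Presburger.linFormula d y.numBound y.system, ?_,
    Presburger.isExistential_linFormula _, ?_, fun u v => ?_⟩
  · rw [htokens, ← happ]
    exact Part.eq_some_iff.2 (Part.mem_map _ hk)
  · have := h.cost_le hV hMs hlen
    rwa [← htokens] at this
  · rw [← h.isSolution_iff hMs, ← hvalid.exists_sat_iff]
    exact Presburger.realize_linFormula hrange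

end Presents

end AffineZVASS

theorem mainTheorem2 :
    (∃ (P : MvPolynomial (Fin 3) ℕ) (f : VASSInput →. List ℕ), Partrec f ∧
      ∀ (d : ℕ) (Q : Type u) [Fintype Q] (V : AffineZVASS d Q), V.FiniteMonoid →
        ∀ (p q : Q) (x : VASSInput), V.IsInput p q x →
          ∃ φ : presburgerOrd.Formula (Fin d ⊕ Fin d),
            f x = Part.some (Presburger.tokens φ) ∧
            φ.IsExistential ∧
            Presburger.formulaSize φ ≤
              MvPolynomial.eval
                ![V.size, Nat.card V.monoid, Nat.log 2 (matSetNorm (V.monoid : Set (Matrix (Fin d) (Fin d) ℤ)))] P ∧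
            ∀ u v : Fin d → ℤ, φ.Realize (Sum.elim u v) ↔ V.Reach (p, u) (q, v)) ∧
    (∀ (d : ℕ) (Q : Type u) [Finite Q] (V : AffineZVASS d Q), V.FiniteMonoid →
      ∀ p q : Q,
        IsSemilinearSet
          {w : (Fin d → ℤ) × (Fin d → ℤ) | V.Reach (p, w.1) (q, w.2)}) := by
  refine ⟨⟨MvPolynomial.C 20000 * (MvPolynomial.X 0 + MvPolynomial.X 1 + MvPolynomial.X 2 +
    MvPolynomial.C 2) ^ 64, VASSInput.algorithm, VASSInput.partrec_algorithm, ?_⟩,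
    fun d Q _ V hV p q => V.isSemilinearSet_reach hV p q⟩
  rintro d Q _ V hV p q x ⟨e, l, hnodup, hmem, hx⟩
  have h : V.Presents p q e l x := ⟨hnodup, hmem, hx⟩
  obtain ⟨φ, h1, h2, h3, h4⟩ := h.exists_formula hV
  refine ⟨φ, h1, h2, h3.trans_eq ?_, h4⟩
  simp [AffineZVASS.measure]
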